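/- For integers $1\le m\le n$, let $V_{n,m}=\{v\in\mathbb R^{n\times m}: v'v=I_m\}$ be the Stiefel manifold ($v'$ is the transpose of $v$) and let $d_*v$ be its $O(n)$-invariant probability measure. For $k+m\le n$, the higher-rank Funk transform and its dual are $$(F_{m,k}f)(u)=\int_{\{v\in V_{n,m}:\,u'v=0\}} f(v)\,d_uv,\quad u\in V_{n,k},\qquad (F^*_{m,k}\varphi)(v)=\int_{\{u\in V_{n,k}:\,v'u=0\}}\varphi(u)\,d_vu,\quad v\in V_{n,m},$$ where $d_uv$ and $d_vu$ are the invariant probability measures on the fibres: if the columns of $\tilde u\in V_{n,n-k}$ form an orthonormal basis of the orthogonal complement of the column space of $u$, then $(F_{m,k}f)(u)=\int_{V_{n-k,m}}f(\tilde u\,\omega)\,d_*\omega$, and similarly for $F^*_{m,k}$. For $2m\le n$ and real $\alpha$, the sine transform of order $\alpha$ is $$(Q^\alpha f)(u)=\int_{V_{n,m}} f(v)\,|\det(I_m-v'uu'v)|^{(\alpha+m-n)/2}\,d_*v,\qquad u\in V_{n,m}.$$ Let $\Gamma_m(\alpha)=\pi^{m(m-1)/4}\prod_{j=0}^{m-1}\Gamma(\alpha-j/2)$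 be the Siegel gamma function. **Theorem.** Let $k,m\ge 1$, $2m\le n-k$, and $f\in L^1(V_{n,m})$ (real- or complex-valued). Then, for almost all $v\in V_{n,m}$, the integrals below (both iterated integrals on the left, and the integral on the right) converge absolutely (the inner one for almost all $u$ in the fibre over $v$), and $$(F^*_{m,k}F_{m,k}f)(v)=\tilde c\,(Q^{\,n-k-m}f)(v),\qquad \tilde c=\frac{\Gamma_m((n-m)/2)\,\Gamma_m((n-k)/2)}{\Gamma_m(n/2)\,\Gamma_m((n-k-m)/2)}.$$ -/

import Mathlib

open MeasureTheory Matrix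

noncomputable section

namespace FunkStiefel

/-! ### The orthogonal group and its normalized Haar measure -/

instance instCompactOrthogonal (n : ℕ) : CompactSpace (Matrix.orthogonalGroup (Fin n) ℝ) := by
  have hcl : IsClosed ((Matrix.orthogonalGroup (Fin n) ℝ : Set (Matrix (Fin n) (Fin n) ℝ))) :=
    isClosed_unitary
  have hK : IsCompact (Set.univ.pi fun _ : Fin n => Set.univ.pi fun _ : Fin n =>
      Set.Icc (-1 : ℝ) 1) :=
    isCompact_univ_pi fun _ => isCompact_univ_pi fun _ => isCompact_Icc
  refine isCompact_iff_compactSpace.mp (hK.of_isClosed_subset hcl ?_)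
  intro g hg i _ j _
  have h := entry_norm_bound_of_unitary (𝕜 := ℝ) hg i j
  rw [Real.norm_eq_abs] at h
  exact abs_le.mp h

instance instMeasurableSpaceOrthogonal (n : ℕ) :
    MeasurableSpace (Matrix.orthogonalGroup (Fin n) ℝ) := borel _

instance instBorelSpaceOrthogonal (n : ℕ) : BorelSpace (Matrix.orthogonalGroup (Fin n) ℝ) := ⟨rfl⟩

/-- The Haar measure of total mass one on `O(n)`. -/
def haarO (n : ℕ) : Measure (Matrix.orthogonalGroup (Fin n) ℝ) :=
  Measure.haarMeasure (⊤ : TopologicalSpace.PositiveCompacts (Matrix.orthogonalGroup (Fin n) ℝ))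

instance instIsProbabilityMeasureHaarO (n : ℕ) : IsProbabilityMeasure (haarO n) :=
  ⟨Measure.haarMeasure_self⟩

/-! ### Stiefel manifolds -/

/-- The Stiefel manifold `V_{n,m}` of real `n × m` matrices `v` with `v'v = I_m`. -/
abbrev Stiefel (n m : ℕ) : Type := {v : Matrix (Fin n) (Fin m) ℝ // vᵀ * v = 1}

instance instMeasurableSpaceStiefel (n m : ℕ) : MeasurableSpace (Stiefel n m) := borel _

instance instBorelSpaceStiefel (n m : ℕ) : BorelSpace (Stiefel n m) := ⟨rfl⟩

/-- The left action of `O(n)` on `V_{n,m}`. -/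
def act {n m : ℕ} (g : Matrix.orthogonalGroup (Fin n) ℝ) (v : Stiefel n m) : Stiefel n m :=
  ⟨g.1 * v.1, by
    have hg : g.1ᵀ * g.1 = 1 := (Matrix.mem_orthogonalGroup_iff' (Fin n) ℝ).mp g.2
    rw [Matrix.transpose_mul, Matrix.mul_assoc, ← Matrix.mul_assoc _ g.1, hg, Matrix.one_mul, v.2]⟩

/-- The frame consisting of the first `m` coordinate vectors of `ℝⁿ`. -/
def baseFrame {n m : ℕ} (h : m ≤ n) : Stiefel n m :=
  ⟨(1 : Matrix (Fin n) (Fin n) ℝ).submatrix id (Fin.castLE h), by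
    rw [Matrix.transpose_submatrix, Matrix.transpose_one,
      ← Matrix.submatrix_mul _ _ _ _ _ Function.bijective_id, Matrix.one_mul,
      Matrix.submatrix_one _ (Fin.castLE_injective h)]⟩

/-- The `O(n)`-invariant probability measure `d_*v` on `V_{n,m} = O(n)/O(n-m)`: the image of the
normalized Haar measure under an orbit map. (For `m > n` the manifold `V_{n,m}` is empty.) -/
def stiefelMeasure (n m : ℕ) : Measure (Stiefel n m) :=
  if h : m ≤ n then (haarO n).map (fun g => act g (baseFrame h)) else 0

lemma continuous_act_left {n m : ℕ} (v : Stiefel n m) :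
    Continuous (fun g : Matrix.orthogonalGroup (Fin n) ℝ => act g v) :=
  Continuous.subtype_mk (Continuous.matrix_mul continuous_subtype_val continuous_const) _

lemma continuous_act_right {n m : ℕ} (g : Matrix.orthogonalGroup (Fin n) ℝ) :
    Continuous (fun v : Stiefel n m => act g v) :=
  Continuous.subtype_mk (Continuous.matrix_mul continuous_const continuous_subtype_val) _

lemma isProbabilityMeasure_stiefelMeasure {n m : ℕ} (h : m ≤ n) :
    IsProbabilityMeasure (stiefelMeasure n m) := by
  rw [stiefelMeasure, dif_pos h]
  exact Measure.isProbabilityMeasure_map (continuous_act_left _).measurable.aemeasurable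

lemma map_act_stiefelMeasure {n m : ℕ} (g : Matrix.orthogonalGroup (Fin n) ℝ) :
    (stiefelMeasure n m).map (act g) = stiefelMeasure n m := by
  unfold stiefelMeasure
  split_ifs with h
  · have hL : (haarO n).map (fun x => g * x) = haarO n :=
      Measure.IsMulLeftInvariant.map_mul_left_eq_self (μ := Measure.haarMeasure
        (⊤ : TopologicalSpace.PositiveCompacts (Matrix.orthogonalGroup (Fin n) ℝ))) g
    conv_rhs => rw [← hL]
    rw [Measure.map_map (continuous_act_right g).measurable (continuous_act_left _).measurable,
      Measure.map_map (continuous_act_left _).measurable (continuous_const_mul g).measurable]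
    congr 1
    funext x
    apply Subtype.ext
    simp [act, Matrix.mul_assoc]
  · simp

/-- If `w ∈ V_{n,p}` and `ω ∈ V_{p,m}` then `wω ∈ V_{n,m}`. -/
def comp {n p m : ℕ} (w : Stiefel n p) (ω : Stiefel p m) : Stiefel n m :=
  ⟨w.1 * ω.1, by
    rw [Matrix.transpose_mul, Matrix.mul_assoc, ← Matrix.mul_assoc _ w.1, w.2, Matrix.one_mul, ω.2]⟩

lemma exists_complFrame {n k : ℕ} (u : Stiefel n k) : ∃ w : Stiefel n (n - k), u.1ᵀ * w.1 = 0 := by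
  have hinner : ∀ x y : EuclideanSpace ℝ (Fin n), inner ℝ x y = ∑ i, x i * y i := by
    intro x y
    rw [PiLp.inner_apply]
    exact Finset.sum_congr rfl fun i _ => mul_comm _ _
  obtain ⟨c, hcu⟩ : ∃ c : Fin k → EuclideanSpace ℝ (Fin n), ∀ i j, c j i = u.1 i j :=
    ⟨fun j => WithLp.toLp 2 (fun i => u.1 i j), fun _ _ => rfl⟩
  have hc : Orthonormal ℝ c := by
    rw [orthonormal_iff_ite]
    intro i j
    have h := congrFun (congrFun u.2 i) j
    rw [Matrix.mul_apply, Matrix.one_apply] at h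
    rw [hinner, ← h]
    exact Finset.sum_congr rfl fun l _ => by rw [hcu, hcu, Matrix.transpose_apply]
  obtain ⟨S, hSdef⟩ : ∃ S : Submodule ℝ (EuclideanSpace ℝ (Fin n)),
    S = Submodule.span ℝ (Set.range c) := ⟨_, rfl⟩
  have hS : Module.finrank ℝ S = k := by
    rw [hSdef, finrank_span_eq_card hc.linearIndependent, Fintype.card_fin]
  have hSo : Module.finrank ℝ Sᗮ = n - k := by
    have h := S.finrank_add_finrank_orthogonal
    rw [finrank_euclideanSpace, Fintype.card_fin] at h
    omega
  let b := (stdOrthonormalBasis ℝ Sᗮ).reindex (finCongr hSo)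
  refine ⟨⟨Matrix.of fun i j => (b j : EuclideanSpace ℝ (Fin n)) i, ?_⟩, ?_⟩
  · ext i j
    have h := (orthonormal_iff_ite.mp b.orthonormal) i j
    rw [Submodule.coe_inner, hinner] at h
    rw [Matrix.mul_apply, Matrix.one_apply, ← h]
    rfl
  · ext i j
    have h1 : c i ∈ S := hSdef ▸ Submodule.subset_span ⟨i, rfl⟩
    have h := (Submodule.mem_orthogonal S _).mp (b j).2 (c i) h1
    rw [hinner] at h
    rw [Matrix.mul_apply, Matrix.zero_apply]
    refine Eq.trans (Finset.sum_congr rfl fun l _ => ?_) h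
    rw [hcu]
    rfl

/-- An orthonormal frame `ũ ∈ V_{n,n-k}` of the orthogonal complement of the span of the columns of
`u ∈ V_{n,k}`. The transforms below do not depend on the choice, see `integral_fibre`. -/
def complFrame {n k : ℕ} (u : Stiefel n k) : Stiefel n (n - k) :=
  (exists_complFrame u).choose

lemma complFrame_spec {n k : ℕ} (u : Stiefel n k) : u.1ᵀ * (complFrame u).1 = 0 :=
  (exists_complFrame u).choose_spec

/-- The element `ũω` of the fibre `{v ∈ V_{n,m} : u'v = 0}` with parameter `ω ∈ V_{n-k,m}`. -/
def fibre {n k m : ℕ} (u : Stiefel n k) (ω : Stiefel (n - k) m) : Stiefel n m :=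
  comp (complFrame u) ω

lemma transpose_mul_fibre {n k m : ℕ} (u : Stiefel n k) (ω : Stiefel (n - k) m) :
    u.1ᵀ * (fibre u ω).1 = 0 := by
  simp [fibre, comp, ← Matrix.mul_assoc, complFrame_spec]

lemma mul_transpose_complFrame {n k : ℕ} (u : Stiefel n k) (w : Stiefel n (n - k))
    (hw : u.1ᵀ * w.1 = 0) : u.1 * u.1ᵀ + w.1 * w.1ᵀ = 1 := by
  have hle : k ≤ n := by
    have hr := Matrix.rank_mul_le_left u.1ᵀ u.1
    rw [u.2, Matrix.rank_one, Fintype.card_fin] at hr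
    exact hr.trans ((Matrix.rank_le_card_width _).trans (by simp))
  have hw' : w.1ᵀ * u.1 = 0 := by
    have h := congrArg Matrix.transpose hw
    rwa [Matrix.transpose_mul, Matrix.transpose_transpose, Matrix.transpose_zero] at h
  have h1 : Matrix.fromRows u.1ᵀ w.1ᵀ * Matrix.fromCols u.1 w.1 = 1 := by
    rw [Matrix.fromRows_mul_fromCols, u.2, w.2, hw, hw', Matrix.fromBlocks_one]
  have e : Fin k ⊕ Fin (n - k) ≃ Fin n :=
    finSumFinEquiv.trans (finCongr (Nat.add_sub_of_le hle))
  rw [Matrix.mul_eq_one_comm_of_equiv e.symm.symm] at h1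
  rwa [Matrix.fromCols_mul_fromRows] at h1

/-! ### The transforms -/

variable {E : Type*} [NormedAddCommGroup E] [NormedSpace ℝ E]

/-- The integral over the fibre `{v : u'v = 0}` does not depend on the frame of the orthogonal
complement of `u` that parametrizes it. -/
lemma integral_fibre {n k m : ℕ} (f : Stiefel n m → E) (u : Stiefel n k) (w : Stiefel n (n - k))
    (hw : u.1ᵀ * w.1 = 0) :
    ∫ ω, f (fibre u ω) ∂(stiefelMeasure (n - k) m) =
      ∫ ω, f (comp w ω) ∂(stiefelMeasure (n - k) m) := by
  have hc := complFrame_spec u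
  have hcc := mul_transpose_complFrame u _ hc
  have hww := mul_transpose_complFrame u w hw
  have hcc' : (complFrame u).1 * (complFrame u).1ᵀ = w.1 * w.1ᵀ :=
    add_left_cancel (hcc.trans hww.symm)
  have hw' : w.1 * (w.1ᵀ * (complFrame u).1) = (complFrame u).1 := by
    rw [← Matrix.mul_assoc, ← hcc', Matrix.mul_assoc, (complFrame u).2, Matrix.mul_one]
  obtain ⟨g, hg⟩ : ∃ g : Matrix.orthogonalGroup (Fin (n - k)) ℝ,
      g.1 = w.1ᵀ * (complFrame u).1 := by
    refine ⟨⟨w.1ᵀ * (complFrame u).1, ?_⟩, rfl⟩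
    rw [Matrix.mem_orthogonalGroup_iff']
    change (w.1ᵀ * (complFrame u).1)ᵀ * (w.1ᵀ * (complFrame u).1) = 1
    rw [Matrix.transpose_mul, Matrix.transpose_transpose, Matrix.mul_assoc, hw',
      (complFrame u).2]
  have hfib : ∀ ω : Stiefel (n - k) m, fibre u ω = comp w (act g ω) := by
    intro ω
    apply Subtype.ext
    change (complFrame u).1 * ω.1 = w.1 * (g.1 * ω.1)
    rw [← Matrix.mul_assoc, hg, hw']
  have hinv : ∀ (a b : Matrix.orthogonalGroup (Fin (n - k)) ℝ), a * b = 1 →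
      ∀ ω : Stiefel (n - k) m, act a (act b ω) = ω := by
    intro a b hab ω
    apply Subtype.ext
    change a.1 * (b.1 * ω.1) = ω.1
    rw [← Matrix.mul_assoc, show a.1 * b.1 = 1 from congrArg Subtype.val hab, Matrix.one_mul]
  let e : Stiefel (n - k) m ≃ₜ Stiefel (n - k) m :=
    { toFun := act g
      invFun := act g⁻¹
      left_inv := hinv _ _ (inv_mul_cancel g)
      right_inv := hinv _ _ (mul_inv_cancel g)
      continuous_toFun := continuous_act_right g
      continuous_invFun := continuous_act_right g⁻¹ }
  have hmp : MeasurePreserving (act g) (stiefelMeasure (n - k) m) (stiefelMeasure (n - k) m) :=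
    ⟨(continuous_act_right g).measurable, map_act_stiefelMeasure g⟩
  simp_rw [hfib]
  exact hmp.integral_comp e.measurableEmbedding (fun ω => f (comp w ω))

/-- The higher-rank Funk transform
`(F_{m,k} f)(u) = ∫_{v ∈ V_{n,m}, u'v = 0} f(v) d_u v`, `u ∈ V_{n,k}`,
with respect to the invariant probability measure on the fibre. -/
def funk (n m k : ℕ) (f : Stiefel n m → E) (u : Stiefel n k) : E :=
  ∫ ω, f (fibre u ω) ∂(stiefelMeasure (n - k) m)

/-- The dual Funk transform
`(F*_{m,k} φ)(v) = ∫_{u ∈ V_{n,k}, v'u = 0} φ(u) d_v u`, `v ∈ V_{n,m}`. -/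
def dualFunk (n m k : ℕ) (φ : Stiefel n k → E) (v : Stiefel n m) : E :=
  ∫ θ, φ (fibre v θ) ∂(stiefelMeasure (n - m) k)

/-- The kernel `|I_m - v'uu'v|^{(α+m-n)/2}` of the sine transform; `|a|` is the absolute value of
the determinant. -/
def sineKernel (n m : ℕ) (α : ℝ) (u v : Stiefel n m) : ℝ :=
  |(1 - v.1ᵀ * u.1 * u.1ᵀ * v.1).det| ^ ((α + m - n) / 2)

/-- The sine transform
`(Q^α f)(u) = ∫_{V_{n,m}} f(v) |I_m - v'uu'v|^{(α+m-n)/2} d_*v`. -/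
def sineTransform (n m : ℕ) (α : ℝ) (f : Stiefel n m → E) (u : Stiefel n m) : E :=
  ∫ v, sineKernel n m α u v • f v ∂(stiefelMeasure n m)

/-- The Siegel gamma function `Γ_m(α) = π^{m(m-1)/4} ∏_{j=0}^{m-1} Γ(α - j/2)`. -/
def siegelGamma (m : ℕ) (α : ℝ) : ℝ :=
  Real.pi ^ ((m : ℝ) * (m - 1) / 4) * ∏ j ∈ Finset.range m, Real.Gamma (α - j / 2)

end FunkStiefel

end

noncomputable section

namespace FunkStiefel

open scoped ENNReal

/-! ### Lebesgue measure on spaces of matrices -/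

section Lebesgue

variable {ι κ ι' : Type*} [Fintype ι] [Fintype κ] [Fintype ι']

/-! Fix `v`. The value `(F*Ff)(v)` is the mean of `f(w)`, where `u` is uniform on the fibre over `v`
and then `w` is uniform on the fibre over `u`. The theorem says that the law of `w` has density `c̃
|I - w'vv'w|^{-k/2}` with respect to `d_*w`; the exponent is `(α+m-n)/2` at `α = n-k-m`.

Let `c` be a frame of the complement of `v`, `A` a fixed frame with `n-m-k` columns in `ℝ^{n-m}`,
and `γ` Haar distributed in `O(n-m)`. Then `w = [v, cγA]ω` with `ω` uniform on `V_{n-k,m}`. The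
uniform `ω` is the orthonormalization of a Gaussian matrix with row blocks `G` and `H`, so `w` is
the orthonormalization of `X = vG + cγAH` (`lintegral_rotatedFrame_coords`). Averaging over `γ`
spreads the degenerate matrix `AH` over all `(n-m) × m` matrices `Y`, and the resulting density
relative to the Gaussian weight is a multiple of `|Y'Y|^{-k/2}`
(`lintegral_orbitAverage_embedding`). Thus `X` has density proportional to `exp(-tr X'X)
|X'cc'X|^{-k/2}`. Writing `X = wR` with `w` orthonormal, and using `cc' = I - vv'`, the second
factor becomes the sine kernel in `w` times `|X'X|^{-k/2}`. The orthonormalization is uniform and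
independent of the Gram matrix under an invariant density (`lintegral_orthonormalize`), so the
kernel separates (`lintegral_rotatedFrame`).

All constants are Gaussian moments of Gram determinants, computed column by column
(`lintegral_gramDet_rpow`); their quotient is `c̃` (`funkConstant_mul`).

The density is symmetric in `v` and `w` and is a probability density, so Tonelli gives integrability
of `f` against the law for almost every `v`. Absolute continuity of the law makes everything
independent of the representative of `f`. -/

instance instMeasureSpaceMatrix : MeasureSpace (Matrix ι κ ℝ) :=
  inferInstanceAs (MeasureSpace (ι → κ → ℝ))

instance instBorelSpaceMatrix : BorelSpace (Matrix ι κ ℝ) :=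
  inferInstanceAs (BorelSpace (ι → κ → ℝ))

instance instSigmaFiniteMatrix : SigmaFinite (volume : Measure (Matrix ι κ ℝ)) :=
  inferInstanceAs (SigmaFinite (volume : Measure (ι → κ → ℝ)))

instance instSecondCountableMatrix : SecondCountableTopology (Matrix ι κ ℝ) :=
  inferInstanceAs (SecondCountableTopology (ι → κ → ℝ))

instance instPolishSpaceMatrix : PolishSpace (Matrix ι κ ℝ) :=
  inferInstanceAs (PolishSpace (ι → κ → ℝ))

lemma lintegral_comp_linearMap {E : Type*} [NormedAddCommGroup E] [NormedSpace ℝ E]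
    [MeasurableSpace E] [BorelSpace E] [FiniteDimensional ℝ E] (μ : Measure E)
    [μ.IsAddHaarMeasure] (L : E →ₗ[ℝ] E) (hL : LinearMap.det L ≠ 0) {F : E → ℝ≥0∞}
    (hF : Measurable F) :
    ENNReal.ofReal |LinearMap.det L| * ∫⁻ x, F (L x) ∂μ = ∫⁻ x, F x ∂μ := by
  have hm : Measurable L := L.continuous_of_finiteDimensional.measurable
  rw [← lintegral_map hF hm, Measure.map_linearMap_addHaar_eq_smul_addHaar μ hL,
    lintegral_smul_measure, smul_eq_mul, ← mul_assoc, ← ENNReal.ofReal_mul (abs_nonneg _),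
    ← abs_mul, mul_inv_cancel₀ hL]
  simp

/-- Each row is transformed separately by `g`, so the Jacobian has one factor `|det g|` per row. -/
lemma lintegral_mul_right [DecidableEq κ] (g : Matrix κ κ ℝ) (hg : g.det ≠ 0)
    {F : Matrix ι κ ℝ → ℝ≥0∞} (hF : Measurable F) :
    ENNReal.ofReal (|g.det| ^ Fintype.card ι) * ∫⁻ X : Matrix ι κ ℝ, F (X * g) = ∫⁻ X, F X := by
  classical
  let L : (ι → κ → ℝ) →ₗ[ℝ] (ι → κ → ℝ) :=
    LinearMap.pi fun i => (Matrix.toLin' gᵀ).comp (LinearMap.proj i)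
  have hdet : LinearMap.det L = g.det ^ Fintype.card ι := by
    simp only [L]
    rw [LinearMap.det_pi]
    simp
  have h := lintegral_comp_linearMap (volume : Measure (ι → κ → ℝ)) L
    (by rw [hdet]; exact pow_ne_zero _ hg) (F := F) hF
  rw [hdet, abs_pow] at h
  refine Eq.trans ?_ h
  congr 1
  refine lintegral_congr fun X => congrArg F ?_
  ext i j
  change (X * g) i j = (Matrix.toLin' gᵀ (X i)) j
  simp [Matrix.mul_apply, Matrix.mulVec, dotProduct, mul_comm]

/-- Here the columns transform separately; conjugation by the transposition `T` reduces this to a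
product of maps. -/
lemma lintegral_mul_left [DecidableEq ι] (g : Matrix ι ι ℝ) (hg : g.det ≠ 0)
    {F : Matrix ι κ ℝ → ℝ≥0∞} (hF : Measurable F) :
    ENNReal.ofReal (|g.det| ^ Fintype.card κ) * ∫⁻ X : Matrix ι κ ℝ, F (g * X) = ∫⁻ X, F X := by
  classical
  let T : (κ → ι → ℝ) ≃ₗ[ℝ] (ι → κ → ℝ) :=
    { toFun := fun x i j => x j i, invFun := fun x i j => x j i, map_add' := fun _ _ => rfl
      map_smul' := fun _ _ => rfl, left_inv := fun _ => rfl, right_inv := fun _ => rfl }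
  let M : (κ → ι → ℝ) →ₗ[ℝ] (κ → ι → ℝ) :=
    LinearMap.pi fun i => (Matrix.toLin' g).comp (LinearMap.proj i)
  let L : (ι → κ → ℝ) →ₗ[ℝ] (ι → κ → ℝ) := T ∘ₗ M ∘ₗ T.symm
  have hdet : LinearMap.det L = g.det ^ Fintype.card κ := by
    simp only [L]
    rw [LinearMap.det_conj]
    simp only [M]
    rw [LinearMap.det_pi]
    simp
  have h := lintegral_comp_linearMap (volume : Measure (ι → κ → ℝ)) L
    (by rw [hdet]; exact pow_ne_zero _ hg) (F := F) hF
  rw [hdet, abs_pow] at h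
  refine Eq.trans ?_ h
  congr 1

lemma lintegral_submatrix_equiv (e : ι' ≃ ι) {F : Matrix ι' κ ℝ → ℝ≥0∞} (hF : Measurable F) :
    ∫⁻ X : Matrix ι κ ℝ, F (X.submatrix e id) = ∫⁻ X, F X := by
  have h := (volume_measurePreserving_piCongrLeft (fun _ : ι => κ → ℝ) e).symm
  refine Eq.trans ?_ (h.lintegral_comp hF)
  rfl

lemma lintegral_fromRows {F : Matrix (ι ⊕ ι') κ ℝ → ℝ≥0∞} (hF : Measurable F) :
    ∫⁻ X, F X = ∫⁻ G : Matrix ι κ ℝ, ∫⁻ H : Matrix ι' κ ℝ, F (fromRows G H) := by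
  have h := volume_measurePreserving_sumPiEquivProdPi_symm (fun _ : ι ⊕ ι' => κ → ℝ)
  have h2 := h.lintegral_comp hF
  have h3 := lintegral_prod (μ := (volume : Measure (ι → κ → ℝ)))
    (ν := (volume : Measure (ι' → κ → ℝ))) _ (hF.comp h.measurable).aemeasurable
  exact h2.symm.trans h3

/-- Multiplication by a square matrix with orthonormal columns preserves Lebesgue measure. -/
lemma lintegral_isometry_mul [DecidableEq ι] (A : Matrix ι ι' ℝ) (hA : A * Aᵀ = 1) (e : ι' ≃ ι)
    {F : Matrix ι κ ℝ → ℝ≥0∞} (hF : Measurable F) :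
    ∫⁻ X : Matrix ι' κ ℝ, F (A * X) = ∫⁻ X, F X := by
  set B : Matrix ι ι ℝ := A.submatrix id e.symm with hB
  have hBB : B * Bᵀ = 1 := by
    rw [hB, Matrix.transpose_submatrix, Matrix.submatrix_mul_equiv, hA]; rfl
  have hd : |B.det| = 1 := by
    have h := congrArg Matrix.det hBB
    rw [Matrix.det_mul, Matrix.det_transpose, Matrix.det_one] at h
    have h2 : |B.det| * |B.det| = 1 := by rw [← abs_mul, h, abs_one]
    nlinarith [abs_nonneg B.det]
  have hm : Measurable fun X : Matrix ι' κ ℝ => F (A * X) :=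
    hF.comp (Continuous.matrix_mul continuous_const continuous_id).measurable
  rw [← lintegral_submatrix_equiv e hm, ← lintegral_mul_left B
    (fun h => by rw [h] at hd; simp at hd) hF, hd]
  simp only [one_pow, ENNReal.ofReal_one, one_mul]
  refine lintegral_congr fun X => congrArg F ?_
  rw [hB, ← Matrix.submatrix_id_id (A.submatrix id e.symm * X)]
  ext i j
  simp only [Matrix.mul_apply, Matrix.submatrix_apply, id]
  exact Fintype.sum_equiv e _ _ (by simp)

lemma lintegral_cons_columns {m : ℕ} {F : Matrix ι (Fin (m + 1)) ℝ → ℝ≥0∞} (hF : Measurable F) :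
    ∫⁻ X, F X = ∫⁻ X : Matrix ι (Fin m) ℝ, ∫⁻ y : ι → ℝ,
      F (Matrix.of fun i => Fin.cons (y i) (X i)) := by
  have h1 := (volume_preserving_piFinSuccAbove (fun _ : Fin (m + 1) => ℝ) 0).symm
  have h2 := volume_preserving_pi (fun _ : ι => h1)
  have h3 := (volume_measurePreserving_arrowProdEquivProdArrow ℝ (Fin m → ℝ) ι).symm
  have h4 := h2.comp h3
  have h5 := h4.lintegral_comp hF
  have h6 := lintegral_prod_symm (μ := (volume : Measure (ι → ℝ)))
    (ν := (volume : Measure (ι → Fin m → ℝ))) _ (hF.comp h4.measurable).aemeasurable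
  refine h5.symm.trans (h6.trans ?_)
  refine lintegral_congr fun X => lintegral_congr fun y => congrArg F ?_
  ext i j
  refine Fin.cases ?_ (fun j => ?_) j <;> rfl

end Lebesgue

/-! ### Gram–Schmidt orthonormalization of the columns of a matrix -/

section GramSchmidt

open InnerProductSpace

lemma gramSchmidt_comp_linearIsometry {E E' : Type*} [NormedAddCommGroup E]
    [InnerProductSpace ℝ E] [NormedAddCommGroup E'] [InnerProductSpace ℝ E'] {m : ℕ}
    (L : E →ₗᵢ[ℝ] E') (x : Fin m → E) (j : Fin m) :
    gramSchmidt ℝ (fun i => L (x i)) j = L (gramSchmidt ℝ x j) := by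
  induction j using WellFoundedLT.induction with
  | ind j ih =>
    rw [gramSchmidt_def, gramSchmidt_def, map_sub, map_sum]
    congr 1
    refine Finset.sum_congr rfl fun i hi => ?_
    rw [ih i (Finset.mem_Iio.1 hi), Submodule.starProjection_singleton,
      Submodule.starProjection_singleton, map_smul, L.inner_map_map, L.norm_map]

lemma measurable_gramSchmidt {E : Type*} [NormedAddCommGroup E] [InnerProductSpace ℝ E]
    [MeasurableSpace E] [BorelSpace E] [SecondCountableTopology E] {m : ℕ} (j : Fin m) :
    Measurable fun x : Fin m → E => gramSchmidt ℝ x j := by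
  induction j using WellFoundedLT.induction with
  | ind j ih =>
    have hdef : (fun x : Fin m → E => gramSchmidt ℝ x j) = fun x => x j - ∑ i ∈ Finset.Iio j,
        (inner ℝ (gramSchmidt ℝ x i) (x j) / ‖gramSchmidt ℝ x i‖ ^ 2) • gramSchmidt ℝ x i := by
      funext x
      rw [gramSchmidt_def]
      simp only [Submodule.starProjection_singleton, RCLike.ofReal_real_eq_id, id]
    rw [hdef]
    refine (measurable_pi_apply j).sub (Finset.measurable_sum _ fun i hi => ?_)
    have h := ih i (Finset.mem_Iio.1 hi)
    exact ((h.inner (measurable_pi_apply j)).div (h.norm.pow_const 2)).smul h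

variable {ι ι' : Type*} [Fintype ι] [Fintype ι'] {m : ℕ}

/-- The columns of a matrix as vectors of a Euclidean space. -/
def euclideanCol (X : Matrix ι (Fin m) ℝ) (j : Fin m) : EuclideanSpace ℝ ι :=
  WithLp.toLp 2 fun i => X i j

/-- The matrix obtained from `X` by Gram–Schmidt orthonormalization of the columns. -/
def orthonormalize (X : Matrix ι (Fin m) ℝ) : Matrix ι (Fin m) ℝ :=
  Matrix.of fun i j => gramSchmidtNormed ℝ (euclideanCol X) j i

lemma inner_euclideanSpace (x y : EuclideanSpace ℝ ι) : inner ℝ x y = ∑ i, x i * y i := by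
  rw [PiLp.inner_apply]
  exact Finset.sum_congr rfl fun i _ => mul_comm _ _

lemma measurable_orthonormalize :
    Measurable (orthonormalize : Matrix ι (Fin m) ℝ → Matrix ι (Fin m) ℝ) := by
  have hc : Measurable (euclideanCol : Matrix ι (Fin m) ℝ → Fin m → EuclideanSpace ℝ ι) := by
    refine measurable_pi_lambda _ fun j => Continuous.measurable ?_
    exact (PiLp.continuous_toLp 2 _).comp
      (continuous_pi fun i => (continuous_apply j).comp (continuous_apply i))
  refine measurable_pi_lambda _ fun i => measurable_pi_lambda _ fun j => ?_
  have h1 := (measurable_gramSchmidt (E := EuclideanSpace ℝ ι) j).comp hc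
  have h2 : Measurable fun X : Matrix ι (Fin m) ℝ =>
      gramSchmidtNormed ℝ (euclideanCol X) j := by
    unfold gramSchmidtNormed
    exact (h1.norm.inv).smul h1
  have h3 : Continuous fun x : EuclideanSpace ℝ ι => x i :=
    (continuous_apply i).comp (PiLp.continuous_ofLp 2 _)
  exact h3.measurable.comp h2

lemma linearIndependent_euclideanCol {X : Matrix ι (Fin m) ℝ} (hX : (Xᵀ * X).det ≠ 0) :
    LinearIndependent ℝ (euclideanCol X) := by
  rw [Fintype.linearIndependent_iff]
  intro c hc
  have h : X *ᵥ c = 0 := by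
    ext i
    have h := congrArg (fun x : EuclideanSpace ℝ ι => x i) hc
    simp only [WithLp.ofLp_sum, WithLp.ofLp_smul, Finset.sum_apply, Pi.smul_apply] at h
    simpa [Matrix.mulVec, dotProduct, euclideanCol, mul_comm] using h
  have h2 : (Xᵀ * X) *ᵥ c = 0 := by rw [← Matrix.mulVec_mulVec, h, Matrix.mulVec_zero]
  exact fun i => congrFun (Matrix.eq_zero_of_mulVec_eq_zero hX h2) i

lemma orthonormalize_transpose_mul_self {X : Matrix ι (Fin m) ℝ} (hX : (Xᵀ * X).det ≠ 0) :
    (orthonormalize X)ᵀ * orthonormalize X = 1 := by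
  ext i j
  have ho : Orthonormal ℝ (gramSchmidtNormed ℝ (euclideanCol X)) :=
    gramSchmidtNormed_orthonormal (linearIndependent_euclideanCol hX)
  have h := orthonormal_iff_ite.mp ho i j
  rw [inner_euclideanSpace] at h
  rw [Matrix.mul_apply, Matrix.one_apply]
  exact h

/-- Gram–Schmidt preserves the span, so each column of `X` equals its expansion in the new
orthonormal system. Triangularity of the coordinate matrix is never needed. -/
lemma orthonormalize_mul {X : Matrix ι (Fin m) ℝ} (hX : (Xᵀ * X).det ≠ 0) :
    orthonormalize X * ((orthonormalize X)ᵀ * X) = X := by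
  set b := gramSchmidtNormed ℝ (euclideanCol X) with hb
  have ho : Orthonormal ℝ b := gramSchmidtNormed_orthonormal (linearIndependent_euclideanCol hX)
  have key : ∀ x ∈ Submodule.span ℝ (Set.range b), ∑ l, inner ℝ (b l) x • b l = x := by
    intro x hx
    induction hx using Submodule.span_induction with
    | mem x h =>
      obtain ⟨l, rfl⟩ := h
      simp [orthonormal_iff_ite.mp ho]
    | zero => simp
    | add x y _ _ hx hy => simp [inner_add_right, add_smul, Finset.sum_add_distrib, hx, hy]
    | smul a x _ hx =>
      conv_rhs => rw [← hx]
      simp [inner_smul_right, mul_smul, Finset.smul_sum]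
  ext i j
  have hmem : euclideanCol X j ∈ Submodule.span ℝ (Set.range b) := by
    rw [hb, span_gramSchmidtNormed_range, span_gramSchmidt]
    exact Submodule.subset_span ⟨j, rfl⟩
  have h := congrArg (fun x : EuclideanSpace ℝ ι => x i) (key _ hmem)
  simp only [WithLp.ofLp_sum, WithLp.ofLp_smul, Finset.sum_apply, Pi.smul_apply,
    inner_euclideanSpace, smul_eq_mul] at h
  rw [Matrix.mul_apply]
  refine Eq.trans (Finset.sum_congr rfl fun l _ => ?_) h
  rw [mul_comm, Matrix.mul_apply]
  rfl

/-- Gram–Schmidt involves only inner products and linear combinations, hence commutes with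
isometries. This equivariance is what makes the orthonormalization of an invariant random matrix
uniform; rectangular `A` is needed for frames. -/
lemma orthonormalize_isometry_mul [DecidableEq ι] {A : Matrix ι' ι ℝ} (hA : Aᵀ * A = 1)
    (X : Matrix ι (Fin m) ℝ) : orthonormalize (A * X) = A * orthonormalize X := by
  let L0 : EuclideanSpace ℝ ι →ₗ[ℝ] EuclideanSpace ℝ ι' :=
    { toFun := fun x => WithLp.toLp 2 (A *ᵥ x.ofLp)
      map_add' := fun x y => by simp [Matrix.mulVec_add]
      map_smul' := fun a x => by simp [Matrix.mulVec_smul] }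
  let L : EuclideanSpace ℝ ι →ₗᵢ[ℝ] EuclideanSpace ℝ ι' := L0.isometryOfInner fun x y => by
    rw [inner_euclideanSpace, inner_euclideanSpace]
    change (A *ᵥ x.ofLp) ⬝ᵥ (A *ᵥ y.ofLp) = x.ofLp ⬝ᵥ y.ofLp
    rw [Matrix.dotProduct_mulVec, Matrix.vecMul_mulVec, hA, Matrix.vecMul_one]
  have hcol : euclideanCol (A * X) = fun j => L (euclideanCol X j) := by
    funext j
    ext i
    simp [euclideanCol, L, L0, Matrix.mul_apply, Matrix.mulVec, dotProduct]
  ext i j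
  have h : gramSchmidtNormed ℝ (euclideanCol (A * X)) j =
      L (gramSchmidtNormed ℝ (euclideanCol X) j) := by
    unfold gramSchmidtNormed
    rw [hcol, gramSchmidt_comp_linearIsometry, map_smul, L.norm_map]
  change gramSchmidtNormed ℝ (euclideanCol (A * X)) j i = _
  rw [h]
  simp [L, L0, orthonormalize, Matrix.mul_apply, Matrix.mulVec, dotProduct]

end GramSchmidt

/-! ### Gaussian moments of Gram determinants -/

section Moments

variable {ι ι' κ : Type*} [Fintype ι] [Fintype ι']

lemma continuous_gram : Continuous fun X : Matrix ι κ ℝ => Xᵀ * X :=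
  continuous_id.matrix_transpose.matrix_mul continuous_id

lemma gram_isometry_mul [DecidableEq ι] {A : Matrix ι' ι ℝ} (hA : Aᵀ * A = 1)
    (X : Matrix ι κ ℝ) : (A * X)ᵀ * (A * X) = Xᵀ * X := by
  rw [Matrix.transpose_mul, Matrix.mul_assoc, ← Matrix.mul_assoc Aᵀ, hA, Matrix.one_mul]

variable [Fintype κ]

/-- The determinant of the Gram matrix of the columns of `X`. -/
def gramDet [DecidableEq κ] (X : Matrix ι κ ℝ) : ℝ := (Xᵀ * X).det

/-- The Gaussian weight `exp (-tr X'X)`. -/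
def gaussWeight (X : Matrix ι κ ℝ) : ℝ≥0∞ := ENNReal.ofReal (Real.exp (-(Xᵀ * X).trace))

lemma measurable_gramDet [DecidableEq κ] : Measurable (gramDet : Matrix ι κ ℝ → ℝ) :=
  continuous_gram.matrix_det.measurable

lemma measurable_gaussWeight : Measurable (gaussWeight : Matrix ι κ ℝ → ℝ≥0∞) :=
  (Real.continuous_exp.comp continuous_gram.matrix_trace.neg).measurable.ennreal_ofReal

lemma gramDet_nonneg [DecidableEq κ] (X : Matrix ι κ ℝ) : 0 ≤ gramDet X := by
  have h := (Matrix.posSemidef_conjTranspose_mul_self X).det_nonneg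
  rwa [Matrix.conjTranspose_eq_transpose_of_trivial] at h

lemma gramDet_mul_square [DecidableEq κ] (X : Matrix ι κ ℝ) (R : Matrix κ κ ℝ) :
    gramDet (X * R) = gramDet X * R.det ^ 2 := by
  unfold gramDet
  rw [Matrix.transpose_mul, Matrix.mul_assoc, ← Matrix.mul_assoc Xᵀ, Matrix.det_mul,
    Matrix.det_mul, Matrix.det_transpose]
  ring

lemma gramDet_isometry_mul [DecidableEq ι] [DecidableEq κ] {A : Matrix ι' ι ℝ} (hA : Aᵀ * A = 1)
    (X : Matrix ι κ ℝ) : gramDet (A * X) = gramDet X := by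
  rw [gramDet, gram_isometry_mul hA, gramDet]

lemma gaussWeight_isometry_mul [DecidableEq ι] {A : Matrix ι' ι ℝ} (hA : Aᵀ * A = 1)
    (X : Matrix ι κ ℝ) : gaussWeight (A * X) = gaussWeight X := by
  rw [gaussWeight, gram_isometry_mul hA, gaussWeight]

lemma gaussWeight_fromRows (G : Matrix ι κ ℝ) (H : Matrix ι' κ ℝ) :
    gaussWeight (fromRows G H) = gaussWeight G * gaussWeight H := by
  unfold gaussWeight
  rw [Matrix.transpose_fromRows, Matrix.fromCols_mul_fromRows, Matrix.trace_add, neg_add,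
    Real.exp_add, ENNReal.ofReal_mul (Real.exp_pos _).le]

lemma gaussWeight_ne_zero (X : Matrix ι κ ℝ) : gaussWeight X ≠ 0 := by
  simp [gaussWeight, Real.exp_pos]

lemma gaussWeight_ne_top (X : Matrix ι κ ℝ) : gaussWeight X ≠ ∞ := ENNReal.ofReal_ne_top

/-- For a single column the Gram determinant is the squared norm, so polar coordinates in `ℝ^d`
reduce the integral to a Gamma integral. -/
lemma lintegral_column_radial {d : ℕ} (hd : 1 ≤ d) {s : ℝ} (hs : 0 < d / 2 + s) :
    ∫⁻ Z : Matrix (Fin d) Unit ℝ, gaussWeight Z * ENNReal.ofReal (gramDet Z ^ s) =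
      ENNReal.ofReal (Real.pi ^ ((d : ℝ) / 2) * (Real.Gamma (d / 2 + s) / Real.Gamma (d / 2))) := by
  have : Nonempty (Fin d) := ⟨⟨0, hd⟩⟩
  have : Nontrivial (EuclideanSpace ℝ (Fin d)) := inferInstance
  set f : ℝ → ℝ := fun r => Real.exp (-r ^ 2) * (r ^ 2) ^ s with hf
  have hmeas : Measurable fun Z : Matrix (Fin d) Unit ℝ =>
      gaussWeight Z * ENNReal.ofReal (gramDet Z ^ s) :=
    measurable_gaussWeight.mul (measurable_gramDet.pow_const s).ennreal_ofReal
  have h1 : MeasurePreserving (fun (x : EuclideanSpace ℝ (Fin d)) (i : Fin d) (_ : Unit) => x i)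
      volume volume :=
    (volume_preserving_pi fun _ : Fin d => (volume_preserving_funUnique Unit ℝ).symm).comp
      (PiLp.volume_preserving_ofLp (Fin d))
  have h2 := h1.lintegral_comp (f := fun Z : Matrix (Fin d) Unit ℝ =>
      gaussWeight Z * ENNReal.ofReal (gramDet Z ^ s)) hmeas
  have h3 : ∀ x : EuclideanSpace ℝ (Fin d),
      gaussWeight (Matrix.of fun i _ => x i : Matrix (Fin d) Unit ℝ) *
        ENNReal.ofReal (gramDet (Matrix.of fun i _ => x i : Matrix (Fin d) Unit ℝ) ^ s) =
      ENNReal.ofReal (f ‖x‖) := by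
    intro x
    have hx : ∀ a b, ((Matrix.of fun i _ => x i : Matrix (Fin d) Unit ℝ)ᵀ *
        (Matrix.of fun i _ => x i : Matrix (Fin d) Unit ℝ)) a b = ‖x‖ ^ 2 := by
      intro a b
      rw [EuclideanSpace.real_norm_sq_eq, Matrix.mul_apply]
      exact Finset.sum_congr rfl fun i _ => (sq _).symm
    rw [gaussWeight, gramDet, Matrix.det_unique, hx, Matrix.trace]
    simp only [Matrix.diag_apply, hx, Finset.univ_unique, Finset.sum_singleton]
    rw [← ENNReal.ofReal_mul (Real.exp_pos _).le]
  have hint : ∀ y ∈ Set.Ioi (0 : ℝ), y ^ (d - 1) • f y =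
      y ^ ((d : ℝ) - 1 + 2 * s) * Real.exp (-y ^ (2 : ℝ)) := by
    intro y hy
    have hy : 0 < y := hy
    have e1 : y ^ (d - 1) = y ^ ((d : ℝ) - 1) := by
      rw [← Real.rpow_natCast, Nat.cast_sub hd, Nat.cast_one]
    have e2 : (y ^ 2) ^ s = y ^ (2 * s) := by
      rw [Real.rpow_mul hy.le]; norm_num
    rw [smul_eq_mul, hf]
    simp only
    rw [e1, e2, Real.rpow_add hy, Real.rpow_two]
    ring
  have hfin : Module.finrank ℝ (EuclideanSpace ℝ (Fin d)) = d := by simp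
  have hq : -1 < (d : ℝ) - 1 + 2 * s := by linarith
  have hI : Integrable (fun x : EuclideanSpace ℝ (Fin d) => f ‖x‖) volume := by
    rw [integrable_fun_norm_addHaar volume (f := f), hfin,
      integrableOn_congr_fun hint measurableSet_Ioi]
    exact integrableOn_rpow_mul_exp_neg_rpow hq two_pos
  refine h2.symm.trans ((lintegral_congr h3).trans ?_)
  rw [← ofReal_integral_eq_lintegral_ofReal hI
    (ae_of_all _ fun x => by positivity), integral_fun_norm_addHaar volume f, hfin,
    setIntegral_congr_fun measurableSet_Ioi hint, integral_rpow_mul_exp_neg_rpow two_pos hq,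
    Measure.real, EuclideanSpace.volume_ball]
  congr 1
  have hd' : (0 : ℝ) < d / 2 := by positivity
  have hG : 0 < Real.Gamma ((d : ℝ) / 2) := Real.Gamma_pos_of_pos hd'
  have e3 : Real.pi ^ ((d : ℝ) / 2) = √Real.pi ^ d := by
    rw [Real.sqrt_eq_rpow, ← Real.rpow_natCast, ← Real.rpow_mul Real.pi_pos.le]
    congr 1; ring
  have e4 : ((d : ℝ) - 1 + 2 * s + 1) / 2 = d / 2 + s := by ring
  have hG' : 0 ≤ Real.Gamma ((d : ℝ) / 2 + 1) := (Real.Gamma_pos_of_pos (by positivity)).le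
  rw [e3, e4, ENNReal.ofReal_one, one_pow, one_mul, Fintype.card_fin,
    ENNReal.toReal_ofReal (by positivity), Real.Gamma_add_one hd'.ne', nsmul_eq_mul, smul_eq_mul]
  field_simp

lemma lintegral_gaussWeight_column (d : ℕ) :
    ∫⁻ Z : Matrix (Fin d) Unit ℝ, gaussWeight Z = ENNReal.ofReal (Real.pi ^ ((d : ℝ) / 2)) := by
  rcases Nat.eq_zero_or_pos d with rfl | hd
  -- Dimension zero occurs when the first column is added to an empty matrix: the space is then a
  -- single point of mass one.
  · have h : (volume : Measure (Matrix (Fin 0) Unit ℝ)) = Measure.dirac 0 :=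
      Measure.volume_pi_eq_dirac (α := fun _ : Fin 0 => Unit → ℝ) _
    rw [h, lintegral_dirac' _ measurable_gaussWeight]
    simp [gaussWeight, Matrix.trace]
  · have h := lintegral_column_radial hd (s := 0) (by positivity)
    have hG : 0 < Real.Gamma ((d : ℝ) / 2) := Real.Gamma_pos_of_pos (by positivity)
    simpa [div_self hG.ne'] using h

lemma ae_gramDet_column_ne_zero {d : ℕ} (hd : 1 ≤ d) :
    ∀ᵐ Z : Matrix (Fin d) Unit ℝ, gramDet Z ≠ 0 := by
  have : Nonempty (Fin d) := ⟨⟨0, hd⟩⟩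
  have h0 : ∀ᵐ Z : Matrix (Fin d) Unit ℝ, Z ≠ 0 :=
    Measure.ae_ne (volume : Measure (Fin d → Unit → ℝ)) 0
  filter_upwards [h0] with Z hZ h
  apply hZ
  rw [gramDet, Matrix.det_unique, Matrix.mul_apply] at h
  have h2 := (Finset.sum_eq_zero_iff_of_nonneg fun i _ => mul_self_nonneg _).mp h
  funext i j
  exact mul_self_eq_zero.mp (h2 i (Finset.mem_univ _))

end Moments

/-! ### Gram determinants column by column -/

section Recursion

lemma Stiefel.le {n m : ℕ} (w : Stiefel n m) : m ≤ n := by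
  have hr := Matrix.rank_mul_le_left w.1ᵀ w.1
  rw [w.2, Matrix.rank_one, Fintype.card_fin] at hr
  exact hr.trans ((Matrix.rank_le_card_width _).trans (by simp))

lemma fromCols_complement {n k : ℕ} (w : Stiefel n k) (c : Stiefel n (n - k))
    (h : w.1ᵀ * c.1 = 0) : (fromCols w.1 c.1)ᵀ * fromCols w.1 c.1 = 1 := by
  have h' : c.1ᵀ * w.1 = 0 := by
    have h2 := congrArg Matrix.transpose h
    rwa [Matrix.transpose_mul, Matrix.transpose_transpose, Matrix.transpose_zero] at h2
  rw [Matrix.transpose_fromCols, Matrix.fromRows_mul_fromCols, w.2, c.2, h, h',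
    Matrix.fromBlocks_one]

lemma fromCols_complement' {n k : ℕ} (w : Stiefel n k) (c : Stiefel n (n - k))
    (h : w.1ᵀ * c.1 = 0) : fromCols w.1 c.1 * (fromCols w.1 c.1)ᵀ = 1 := by
  rw [Matrix.transpose_fromCols, Matrix.fromCols_mul_fromRows]
  exact mul_transpose_complFrame w c h

/-- The index equivalence for the columns of a frame together with those of a complementary one. -/
def complEquiv {n k : ℕ} (h : k ≤ n) : Fin k ⊕ Fin (n - k) ≃ Fin n :=
  finSumFinEquiv.trans (finCongr (Nat.add_sub_of_le h))

/-- Integration over matrices in coordinates adapted to a frame and a complementary frame. -/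
lemma lintegral_frame_coords {n k : ℕ} {κ : Type*} [Fintype κ] (w : Stiefel n k)
    (c : Stiefel n (n - k)) (h : w.1ᵀ * c.1 = 0) {F : Matrix (Fin n) κ ℝ → ℝ≥0∞}
    (hF : Measurable F) :
    ∫⁻ X, F X = ∫⁻ G : Matrix (Fin k) κ ℝ, ∫⁻ H : Matrix (Fin (n - k)) κ ℝ,
      F (w.1 * G + c.1 * H) := by
  have hm : Measurable fun X : Matrix (Fin k ⊕ Fin (n - k)) κ ℝ => F (fromCols w.1 c.1 * X) :=
    hF.comp (Continuous.matrix_mul continuous_const continuous_id).measurable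
  rw [← lintegral_isometry_mul _ (fromCols_complement' w c h) (complEquiv w.le) hF,
    lintegral_fromRows hm]
  simp_rw [Matrix.fromCols_mul_fromRows]

/-- The frame spanned by a matrix of full rank. -/
def frameOf {n m : ℕ} {X : Matrix (Fin n) (Fin m) ℝ} (hX : gramDet X ≠ 0) : Stiefel n m :=
  ⟨orthonormalize X, orthonormalize_transpose_mul_self hX⟩

/-- The matrix of coordinates of the columns of `X` with respect to `orthonormalize X`. -/
def coordsOf {n m : ℕ} (X : Matrix (Fin n) (Fin m) ℝ) : Matrix (Fin m) (Fin m) ℝ :=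
  (orthonormalize X)ᵀ * X

lemma frameOf_mul_coordsOf {n m : ℕ} {X : Matrix (Fin n) (Fin m) ℝ} (hX : gramDet X ≠ 0) :
    (frameOf hX).1 * coordsOf X = X :=
  orthonormalize_mul hX

lemma gramDet_square {κ : Type*} [Fintype κ] [DecidableEq κ] (R : Matrix κ κ ℝ) :
    gramDet R = R.det ^ 2 := by
  rw [gramDet, Matrix.det_mul, Matrix.det_transpose, sq]

lemma gramDet_eq_coordsOf {n m : ℕ} {X : Matrix (Fin n) (Fin m) ℝ} (hX : gramDet X ≠ 0) :
    gramDet X = (coordsOf X).det ^ 2 := by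
  conv_lhs => rw [← frameOf_mul_coordsOf hX, gramDet_isometry_mul (frameOf hX).2]
  exact gramDet_square _

lemma det_coordsOf_ne_zero {n m : ℕ} {X : Matrix (Fin n) (Fin m) ℝ} (hX : gramDet X ≠ 0) :
    (coordsOf X).det ≠ 0 := by
  intro h
  rw [gramDet_eq_coordsOf hX, h] at hX
  simp at hX

/-- The matrix `X` with the column `Y` put in front. -/
def consColumn {ι : Type*} {m : ℕ} (Y : Matrix ι Unit ℝ) (X : Matrix ι (Fin m) ℝ) :
    Matrix ι (Fin (m + 1)) ℝ :=
  Matrix.of fun i => Fin.cons (Y i ()) (X i)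

variable {ι : Type*}

lemma lintegral_consColumn [Fintype ι] {m : ℕ} {F : Matrix ι (Fin (m + 1)) ℝ → ℝ≥0∞} (hF : Measurable F) :
    ∫⁻ X, F X = ∫⁻ X : Matrix ι (Fin m) ℝ, ∫⁻ Y : Matrix ι Unit ℝ, F (consColumn Y X) := by
  rw [lintegral_cons_columns hF]
  refine lintegral_congr fun X => ?_
  have h := volume_preserving_pi fun _ : ι => volume_preserving_funUnique Unit ℝ
  refine Eq.symm (Eq.trans ?_ (h.lintegral_comp
    (f := fun y => F (Matrix.of fun i => Fin.cons (y i) (X i))) (hF.comp ?_)))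
  · rfl
  · refine measurable_pi_lambda _ fun i => measurable_pi_lambda _ fun j => ?_
    refine Fin.cases ?_ (fun j => ?_) j
    · exact measurable_pi_apply i
    · exact measurable_const

/-- The column indices of `consColumn`. -/
def consEquiv (m : ℕ) : Unit ⊕ Fin m ≃ Fin (m + 1) where
  toFun := Sum.elim (fun _ => 0) Fin.succ
  invFun := Fin.cases (Sum.inl ()) Sum.inr
  left_inv := by rintro (_ | _) <;> simp
  right_inv := by intro j; refine Fin.cases ?_ (fun j => ?_) j <;> simp

lemma consColumn_submatrix {m : ℕ} (Y : Matrix ι Unit ℝ) (X : Matrix ι (Fin m) ℝ) :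
    (consColumn Y X).submatrix id (consEquiv m) = fromCols Y X := by
  ext i (_ | _) <;> simp [consColumn, consEquiv]

lemma gramDet_consColumn [Fintype ι] {m : ℕ} (Y : Matrix ι Unit ℝ) (X : Matrix ι (Fin m) ℝ) :
    gramDet (consColumn Y X) = gramDet (fromCols Y X) := by
  unfold gramDet
  rw [← consColumn_submatrix, Matrix.transpose_submatrix,
    ← Matrix.submatrix_mul _ _ _ _ _ Function.bijective_id, Matrix.det_submatrix_equiv_self]

lemma gaussWeight_consColumn [Fintype ι] {m : ℕ} (Y : Matrix ι Unit ℝ) (X : Matrix ι (Fin m) ℝ) :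
    gaussWeight (consColumn Y X) = gaussWeight Y * gaussWeight X := by
  unfold gaussWeight
  rw [← ENNReal.ofReal_mul (Real.exp_pos _).le, ← Real.exp_add, ← neg_add]
  congr 3
  simp only [Matrix.trace, Matrix.diag_apply, Fin.sum_univ_succ, Finset.univ_unique,
    Finset.sum_singleton, Matrix.mul_apply, Matrix.transpose_apply]
  rfl

/-- The Gram determinant of `[Y, X]` in coordinates adapted to the column space of `X`. -/
lemma gramDet_fromCols_coords {n m : ℕ} {X : Matrix (Fin n) (Fin m) ℝ} (hX : gramDet X ≠ 0)
    (c : Stiefel n (n - m)) (hc : (frameOf hX).1ᵀ * c.1 = 0) (Z₁ : Matrix (Fin m) Unit ℝ)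
    (Z₂ : Matrix (Fin (n - m)) Unit ℝ) :
    gramDet (fromCols ((frameOf hX).1 * Z₁ + c.1 * Z₂) X) = gramDet X * gramDet Z₂ := by
  -- The component `Z₁` along the column space of `X` goes into a square block triangular factor,
  -- whose determinant does not see it. The remaining factor has orthogonal blocks, so only the
  -- squared distance `gramDet Z₂` enters.
  have h1 : fromCols ((frameOf hX).1 * Z₁ + c.1 * Z₂) X =
      fromCols (frameOf hX).1 c.1 * ((fromBlocks 0 1 Z₂ 0 :
        Matrix (Fin m ⊕ Fin (n - m)) (Unit ⊕ Fin m) ℝ) *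
          (fromBlocks 1 0 Z₁ (coordsOf X) : Matrix (Unit ⊕ Fin m) (Unit ⊕ Fin m) ℝ)) := by
    rw [Matrix.fromBlocks_multiply, Matrix.fromCols_mul_fromBlocks]
    simp [frameOf_mul_coordsOf]
  rw [h1, gramDet_isometry_mul (fromCols_complement _ _ hc), gramDet_mul_square,
    Matrix.det_fromBlocks_zero₁₂, Matrix.det_one, one_mul, gramDet_eq_coordsOf hX, mul_comm]
  congr 1
  unfold gramDet
  rw [Matrix.fromBlocks_transpose, Matrix.fromBlocks_multiply]
  simp

/-- Split the new column into its parts along and orthogonal to the column space of `X`. The Gram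
determinant depends only on the orthogonal part, so the other `m` coordinates contribute a plain
Gaussian integral. This is the induction step for both results below. -/
lemma lintegral_column_coords {n m : ℕ} {X : Matrix (Fin n) (Fin m) ℝ} (hX : gramDet X ≠ 0)
    {Φ : ℝ → ℝ≥0∞} (hΦ : Measurable Φ) :
    ∫⁻ Y : Matrix (Fin n) Unit ℝ, gaussWeight Y * Φ (gramDet (consColumn Y X)) =
      ENNReal.ofReal (Real.pi ^ ((m : ℝ) / 2)) *
        ∫⁻ Z : Matrix (Fin (n - m)) Unit ℝ, gaussWeight Z * Φ (gramDet X * gramDet Z) := by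
  obtain ⟨c, hc⟩ := exists_complFrame (frameOf hX)
  have hm : Measurable fun Y : Matrix (Fin n) Unit ℝ =>
      gaussWeight Y * Φ (gramDet (fromCols Y X)) := by
    refine measurable_gaussWeight.mul (hΦ.comp (measurable_gramDet.comp (Continuous.measurable ?_)))
    refine continuous_matrix fun i j => ?_
    rcases j with j | j
    · exact continuous_id.matrix_elem i j
    · exact continuous_const
  simp_rw [gramDet_consColumn]
  rw [lintegral_frame_coords (frameOf hX) c hc hm, ← lintegral_gaussWeight_column,
    ← lintegral_mul_const _ measurable_gaussWeight]
  refine lintegral_congr fun Z₁ => ?_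
  have hZ : Measurable fun Z : Matrix (Fin (n - m)) Unit ℝ =>
      gaussWeight Z * Φ (gramDet X * gramDet Z) :=
    measurable_gaussWeight.mul (hΦ.comp (measurable_const.mul measurable_gramDet))
  rw [← lintegral_const_mul _ hZ]
  refine lintegral_congr fun Z₂ => ?_
  rw [gramDet_fromCols_coords hX c hc, ← Matrix.fromCols_mul_fromRows,
    gaussWeight_isometry_mul (fromCols_complement _ _ hc), gaussWeight_fromRows, mul_assoc]

lemma ae_gramDet_ne_zero {n m : ℕ} (h : m ≤ n) :
    ∀ᵐ X : Matrix (Fin n) (Fin m) ℝ, gramDet X ≠ 0 := by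
  induction m with
  | zero => exact ae_of_all _ fun X => by simp [gramDet]
  | succ m ih =>
    -- Since the Gaussian weight is strictly positive, the singular matrices form a null set as soon
    -- as the weighted integral of this indicator vanishes.
    set Φ : ℝ → ℝ≥0∞ := ({0} : Set ℝ).indicator 1 with hΦdef
    have hΦ : Measurable Φ := measurable_one.indicator (measurableSet_singleton 0)
    have hF : Measurable fun X : Matrix (Fin n) (Fin (m + 1)) ℝ => gaussWeight X * Φ (gramDet X) :=
      measurable_gaussWeight.mul (hΦ.comp measurable_gramDet)
    have h0 : ∫⁻ X : Matrix (Fin n) (Fin (m + 1)) ℝ, gaussWeight X * Φ (gramDet X) = 0 := by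
      rw [lintegral_consColumn hF, ← lintegral_zero]
      refine lintegral_congr_ae ?_
      filter_upwards [ih (by omega)] with X hX
      have h1 := lintegral_column_coords hX hΦ
      have h2 : ∫⁻ Z : Matrix (Fin (n - m)) Unit ℝ, gaussWeight Z * Φ (gramDet X * gramDet Z)
          = 0 := by
        rw [← lintegral_zero]
        refine lintegral_congr_ae ?_
        filter_upwards [ae_gramDet_column_ne_zero (d := n - m) (by omega)] with Z hZ
        simp [hΦdef, hX, hZ]
      rw [h2, mul_zero] at h1
      have hc : Measurable fun Y : Matrix (Fin n) Unit ℝ =>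
          gaussWeight Y * Φ (gramDet (consColumn Y X)) := by
        refine measurable_gaussWeight.mul (hΦ.comp (measurable_gramDet.comp ?_))
        refine measurable_pi_lambda _ fun i => measurable_pi_lambda _ fun j => ?_
        refine Fin.cases ?_ (fun j => ?_) j
        · exact (continuous_id.matrix_elem i ()).measurable
        · exact measurable_const
      simp_rw [gaussWeight_consColumn, mul_right_comm (gaussWeight _) (gaussWeight X)]
      rw [lintegral_mul_const _ hc, h1, zero_mul]
    rw [lintegral_eq_zero_iff hF] at h0
    filter_upwards [h0] with X hX hX0
    simp [hΦdef, hX0, gaussWeight_ne_zero] at hX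

/-- The Gaussian moments of the Gram determinant of an `n × m` matrix. -/
lemma lintegral_gramDet_rpow {n m : ℕ} {s : ℝ} (h : m ≤ n) (hs : 0 < ((n : ℝ) - m + 1) / 2 + s) :
    ∫⁻ X : Matrix (Fin n) (Fin m) ℝ, gaussWeight X * ENNReal.ofReal (gramDet X ^ s) =
      ENNReal.ofReal (Real.pi ^ ((n : ℝ) * m / 2) * ∏ j ∈ Finset.range m,
        (Real.Gamma (((n : ℝ) - j) / 2 + s) / Real.Gamma (((n : ℝ) - j) / 2))) := by
  have hF : ∀ m : ℕ, Measurable fun X : Matrix (Fin n) (Fin m) ℝ =>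
      gaussWeight X * ENNReal.ofReal (gramDet X ^ s) := fun m =>
    measurable_gaussWeight.mul (measurable_gramDet.pow_const s).ennreal_ofReal
  have hF' : ∀ d : ℕ, Measurable fun X : Matrix (Fin d) Unit ℝ =>
      gaussWeight X * ENNReal.ofReal (gramDet X ^ s) := fun d =>
    measurable_gaussWeight.mul (measurable_gramDet.pow_const s).ennreal_ofReal
  induction m with
  | zero =>
    have hv : (volume : Measure (Matrix (Fin n) (Fin 0) ℝ)) Set.univ = 1 := by
      change (volume : Measure (Fin n → Fin 0 → ℝ)) Set.univ = 1
      simp [volume_pi, Measure.pi_univ]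
    have h1 : ∀ X : Matrix (Fin n) (Fin 0) ℝ,
        gaussWeight X * ENNReal.ofReal (gramDet X ^ s) = 1 := fun X => by
      simp [gaussWeight, gramDet, Matrix.trace]
    simp [h1, hv]
  | succ m ih =>
    have hnm : (m : ℝ) + 1 ≤ n := by exact_mod_cast h
    push_cast at hs
    have hsub : ((n - m : ℕ) : ℝ) = n - m := by rw [Nat.cast_sub (by omega)]
    set D : ℝ≥0∞ := ENNReal.ofReal (Real.pi ^ (((n - m : ℕ) : ℝ) / 2) *
      (Real.Gamma (((n - m : ℕ) : ℝ) / 2 + s) / Real.Gamma (((n - m : ℕ) : ℝ) / 2))) with hD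
    -- Given `m` independent columns, a further column contributes the radial moment in dimension `n
    -- - m`, independently of `X`.
    have hcol : ∀ᵐ X : Matrix (Fin n) (Fin m) ℝ,
        ∫⁻ Y : Matrix (Fin n) Unit ℝ, gaussWeight (consColumn Y X) *
          ENNReal.ofReal (gramDet (consColumn Y X) ^ s) =
        gaussWeight X * ENNReal.ofReal (gramDet X ^ s) *
          (ENNReal.ofReal (Real.pi ^ ((m : ℝ) / 2)) * D) := by
      filter_upwards [ae_gramDet_ne_zero (show m ≤ n by omega)] with X hX
      have h1 := lintegral_column_coords hX (Φ := fun t => ENNReal.ofReal (t ^ s))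
        (measurable_id.pow_const s).ennreal_ofReal
      simp_rw [Real.mul_rpow (gramDet_nonneg _) (gramDet_nonneg _),
        ENNReal.ofReal_mul (Real.rpow_nonneg (gramDet_nonneg X) s),
        mul_left_comm (gaussWeight _)] at h1
      rw [lintegral_const_mul _ (hF' _), lintegral_column_radial (by omega)
        (by rw [hsub]; linarith), ← hD] at h1
      simp_rw [gaussWeight_consColumn, mul_comm (gaussWeight _) (gaussWeight X), mul_assoc]
      rw [lintegral_const_mul' _ _ (gaussWeight_ne_top X), h1]
      ring
    rw [lintegral_consColumn (hF _), lintegral_congr_ae hcol, lintegral_mul_const _ (hF _),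
      ih (by omega) (by linarith), hD, hsub, ← ENNReal.ofReal_mul (by positivity),
      ← ENNReal.ofReal_mul']
    · congr 1
      rw [Finset.prod_range_succ]
      have e : Real.pi ^ ((n : ℝ) * ((m + 1 : ℕ) : ℝ) / 2) = Real.pi ^ ((n : ℝ) * m / 2) *
          (Real.pi ^ ((m : ℝ) / 2) * Real.pi ^ (((n : ℝ) - m) / 2)) := by
        rw [← Real.rpow_add Real.pi_pos, ← Real.rpow_add Real.pi_pos]
        congr 1; push_cast; ring
      rw [e]
      ring
    · have h1 : 0 < Real.Gamma (((n : ℝ) - m) / 2 + s) := Real.Gamma_pos_of_pos (by linarith)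
      have h2 : 0 < Real.Gamma (((n : ℝ) - m) / 2) := Real.Gamma_pos_of_pos (by linarith)
      positivity

end Recursion

/-! ### Averages over the orthogonal group -/

section Averaging

instance instIsMulLeftInvariantHaarO (n : ℕ) : (haarO n).IsMulLeftInvariant :=
  inferInstanceAs (Measure.haarMeasure
    (⊤ : TopologicalSpace.PositiveCompacts (Matrix.orthogonalGroup (Fin n) ℝ))).IsMulLeftInvariant

instance instSecondCountableOrthogonal (n : ℕ) :
    SecondCountableTopology (Matrix.orthogonalGroup (Fin n) ℝ) :=
  TopologicalSpace.Subtype.secondCountableTopology _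

/-- Integrate `f(a⁻¹b)` in both orders: by left invariance, `b` first gives the integral of `f`,
while `a` first gives that of `f(a⁻¹)`. Right invariance follows. -/
lemma haarO_inv (n : ℕ) : (haarO n).inv = haarO n := by
  refine Measure.ext_of_lintegral _ fun f hf => ?_
  have hf2 : Measurable fun p : orthogonalGroup (Fin n) ℝ × orthogonalGroup (Fin n) ℝ =>
      f (p.1⁻¹ * p.2) := hf.comp (by fun_prop)
  have h1 : ∀ a : orthogonalGroup (Fin n) ℝ,
      ∫⁻ b, f (a⁻¹ * b) ∂haarO n = ∫⁻ b, f b ∂haarO n := fun a =>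
    lintegral_mul_left_eq_self f a⁻¹
  have h2 : ∀ b : orthogonalGroup (Fin n) ℝ,
      ∫⁻ a, f (a⁻¹ * b) ∂haarO n = ∫⁻ a, f a⁻¹ ∂haarO n := fun b => by
    rw [← lintegral_mul_left_eq_self _ b]
    simp
  have h3 := lintegral_lintegral_swap (μ := haarO n) (ν := haarO n)
    (f := fun a b => f (a⁻¹ * b)) hf2.aemeasurable
  simp_rw [h1, h2] at h3
  rw [Measure.inv_def, lintegral_map hf measurable_inv]
  simpa using h3.symm

instance instIsMulRightInvariantHaarO (n : ℕ) : (haarO n).IsMulRightInvariant := by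
  rw [← haarO_inv n]
  infer_instance

lemma exists_act_eq {n m : ℕ} (w₁ w₂ : Stiefel n m) :
    ∃ g : orthogonalGroup (Fin n) ℝ, g.1 * w₁.1 = w₂.1 := by
  obtain ⟨c₁, hc₁⟩ := exists_complFrame w₁
  obtain ⟨c₂, hc₂⟩ := exists_complFrame w₂
  have hc₁' : c₁.1ᵀ * w₁.1 = 0 := by
    have h := congrArg Matrix.transpose hc₁
    rwa [Matrix.transpose_mul, Matrix.transpose_transpose, Matrix.transpose_zero] at h
  refine ⟨⟨fromCols w₂.1 c₂.1 * (fromCols w₁.1 c₁.1)ᵀ, ?_⟩, ?_⟩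
  · rw [Matrix.mem_orthogonalGroup_iff]
    change (fromCols w₂.1 c₂.1 * (fromCols w₁.1 c₁.1)ᵀ) *
      (fromCols w₂.1 c₂.1 * (fromCols w₁.1 c₁.1)ᵀ)ᵀ = 1
    rw [Matrix.transpose_mul, Matrix.transpose_transpose, Matrix.mul_assoc,
      ← Matrix.mul_assoc (fromCols w₁.1 c₁.1)ᵀ, fromCols_complement _ _ hc₁, Matrix.one_mul,
      fromCols_complement' _ _ hc₂]
  · change fromCols w₂.1 c₂.1 * (fromCols w₁.1 c₁.1)ᵀ * w₁.1 = w₂.1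
    rw [Matrix.transpose_fromCols, Matrix.fromCols_mul_fromRows, Matrix.add_mul,
      Matrix.mul_assoc, Matrix.mul_assoc, w₁.2, hc₁']
    simp

/-- Invariance of a function under the left action of `O(q)`. -/
def LeftInvariant {q : ℕ} {κ : Type*} (F : Matrix (Fin q) κ ℝ → ℝ≥0∞) : Prop :=
  ∀ (h : orthogonalGroup (Fin q) ℝ) X, F (h.1 * X) = F X

/-- The average of `F` over the orbits of `O(n)`. -/
def orbitAverage {n : ℕ} {κ : Type*} (F : Matrix (Fin n) κ ℝ → ℝ≥0∞) (X : Matrix (Fin n) κ ℝ) :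
    ℝ≥0∞ :=
  ∫⁻ h, F (h.1 * X) ∂haarO n

variable {n m : ℕ} {κ : Type*}

lemma orbitAverage_act (F : Matrix (Fin n) κ ℝ → ℝ≥0∞) (g : orthogonalGroup (Fin n) ℝ)
    (X : Matrix (Fin n) κ ℝ) : orbitAverage F (g.1 * X) = orbitAverage F X := by
  unfold orbitAverage
  rw [← lintegral_mul_right_eq_self (fun h => F (h.1 * X)) g]
  simp [Matrix.mul_assoc]

lemma orbitAverage_frame_mul [Fintype κ] (F : Matrix (Fin n) κ ℝ → ℝ≥0∞) (w₁ w₂ : Stiefel n m)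
    (R : Matrix (Fin m) κ ℝ) : orbitAverage F (w₁.1 * R) = orbitAverage F (w₂.1 * R) := by
  obtain ⟨g, hg⟩ := exists_act_eq w₁ w₂
  rw [← hg, Matrix.mul_assoc, orbitAverage_act]

lemma measurable_orbit_mul [Fintype κ] :
    Measurable fun p : Matrix (Fin n) κ ℝ × orthogonalGroup (Fin n) ℝ => p.2.1 * p.1 :=
  (Continuous.matrix_mul (continuous_subtype_val.comp continuous_snd) continuous_fst).measurable

lemma measurable_orbitAverage [Fintype κ] {F : Matrix (Fin n) κ ℝ → ℝ≥0∞} (hF : Measurable F) :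
    Measurable (orbitAverage F) :=
  (hF.comp measurable_orbit_mul).lintegral_prod_right'

lemma orthogonal_transpose_mul (h : orthogonalGroup (Fin n) ℝ) : h.1ᵀ * h.1 = 1 :=
  (Matrix.mem_orthogonalGroup_iff' (Fin n) ℝ).mp h.2

/-- Each rotation preserves both Lebesgue measure and `φ`, so averaging `F` over orbits does not
change the integral. -/
lemma lintegral_orbitAverage_mul [Fintype κ] {F φ : Matrix (Fin n) κ ℝ → ℝ≥0∞}
    (hF : Measurable F) (hφ : Measurable φ)
    (hinv : LeftInvariant φ) :
    ∫⁻ X, orbitAverage F X * φ X = ∫⁻ X, F X * φ X := by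
  have hFφ : Measurable fun X => F X * φ X := hF.mul hφ
  have h1 : ∀ X, orbitAverage F X * φ X = ∫⁻ h, F (h.1 * X) * φ (h.1 * X) ∂haarO n := fun X => by
    simp_rw [hinv _ X]
    rw [lintegral_mul_const]
    · rfl
    · exact hF.comp (measurable_orbit_mul.comp measurable_prodMk_left)
  simp_rw [h1]
  rw [lintegral_lintegral_swap (f := fun X (h : orthogonalGroup (Fin n) ℝ) =>
    F (h.1 * X) * φ (h.1 * X)) (hFφ.comp measurable_orbit_mul).aemeasurable]
  have h2 : ∀ h : orthogonalGroup (Fin n) ℝ,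
      ∫⁻ X : Matrix (Fin n) κ ℝ, F (h.1 * X) * φ (h.1 * X) = ∫⁻ X, F X * φ X := fun h =>
    lintegral_isometry_mul h.1 ((Matrix.mem_orthogonalGroup_iff (Fin n) ℝ).mp h.2)
      (Equiv.refl _) hFφ
  simp_rw [h2]
  simp

/-- By transitivity and right invariance of Haar measure, any frame can replace the base frame of
the orbit map. -/
lemma lintegral_stiefelMeasure {F : Matrix (Fin n) (Fin m) ℝ → ℝ≥0∞} (hF : Measurable F)
    (w : Stiefel n m) : ∫⁻ v, F v.1 ∂stiefelMeasure n m = orbitAverage F w.1 := by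
  have h := orbitAverage_frame_mul F w (baseFrame w.le) 1
  rw [Matrix.mul_one, Matrix.mul_one] at h
  rw [h, stiefelMeasure, dif_pos w.le, lintegral_map (f := fun v : Stiefel n m => F v.1)
    (hF.comp continuous_subtype_val.measurable)
    (continuous_act_left _).measurable]
  rfl

/-- The orthonormalization of a random matrix with `O(n)`-invariant density is uniformly distributed
and independent of the Gram matrix. -/
lemma lintegral_orthonormalize (hmn : m ≤ n) {F : Matrix (Fin n) (Fin m) ℝ → ℝ≥0∞}
    (hF : Measurable F) {φ : Matrix (Fin n) (Fin m) ℝ → ℝ≥0∞} (hφ : Measurable φ)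
    (hinv : LeftInvariant φ) :
    ∫⁻ X, F (orthonormalize X) * φ X = (∫⁻ v, F v.1 ∂stiefelMeasure n m) * ∫⁻ X, φ X := by
  refine (lintegral_orbitAverage_mul (hF.comp measurable_orthonormalize) hφ hinv).symm.trans ?_
  rw [← lintegral_const_mul _ hφ]
  refine lintegral_congr_ae ?_
  filter_upwards [ae_gramDet_ne_zero hmn] with X hX
  rw [lintegral_stiefelMeasure hF (frameOf hX)]
  congr 1
  unfold orbitAverage
  refine lintegral_congr fun h => ?_
  rw [Function.comp, orthonormalize_isometry_mul (orthogonal_transpose_mul h)]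
  rfl

end Averaging

/-! ### Polar coordinates by a double integral -/

section Polar

variable {q r m : ℕ}

/-- The integral of an `O(q)`-invariant function in polar coordinates, up to a constant. -/
def polarIntegral (B : Stiefel q m) (d : ℕ) (F : Matrix (Fin q) (Fin m) ℝ → ℝ≥0∞) : ℝ≥0∞ :=
  ∫⁻ g : Matrix (Fin m) (Fin m) ℝ, F (B.1 * g) * ENNReal.ofReal (|g.det| ^ d)

/-- The weight `|X'X|^{d/2} exp (-tr X'X)`. -/
def detWeight (d : ℕ) {ι : Type*} [Fintype ι] (X : Matrix ι (Fin m) ℝ) : ℝ≥0∞ :=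
  gaussWeight X * ENNReal.ofReal (√(gramDet X) ^ d)

lemma measurable_detWeight (d : ℕ) {ι : Type*} [Fintype ι] :
    Measurable (detWeight d : Matrix ι (Fin m) ℝ → ℝ≥0∞) :=
  measurable_gaussWeight.mul (measurable_gramDet.sqrt.pow_const d).ennreal_ofReal

lemma measurable_mul_const_left {ι ι' κ : Type*} [Fintype ι] [Fintype ι'] [Fintype κ]
    (A : Matrix ι ι' ℝ) : Measurable fun X : Matrix ι' κ ℝ => A * X :=
  (Continuous.matrix_mul continuous_const continuous_id).measurable

lemma measurable_abs_det_pow (d : ℕ) :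
    Measurable fun g : Matrix (Fin m) (Fin m) ℝ => ENNReal.ofReal (|g.det| ^ d) :=
  ((continuous_id.matrix_det.abs).pow d).measurable.ennreal_ofReal

lemma measurable_matrix_inv :
    Measurable fun g : Matrix (Fin m) (Fin m) ℝ => g⁻¹ := by
  simp_rw [Matrix.inv_def, Ring.inverse_eq_inv']
  exact (continuous_id.matrix_det.measurable.inv).smul continuous_id.matrix_adjugate.measurable

lemma ae_det_ne_zero : ∀ᵐ g : Matrix (Fin m) (Fin m) ℝ, g.det ≠ 0 := by
  filter_upwards [ae_gramDet_ne_zero le_rfl] with g hg h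
  rw [gramDet_square, h] at hg
  simp at hg

lemma LeftInvariant.frame_mul {κ : Type*} {F : Matrix (Fin q) κ ℝ → ℝ≥0∞}
    (hF : LeftInvariant F) (w₁ w₂ : Stiefel q m) (R : Matrix (Fin m) κ ℝ) :
    F (w₁.1 * R) = F (w₂.1 * R) := by
  obtain ⟨g, hg⟩ := exists_act_eq w₁ w₂
  rw [← hg, Matrix.mul_assoc, hF]

/-- Write `X = wR`. Left invariance replaces the frame `Aw` by `B`, and the substitution `g ↦ Rg`
produces `|det R|^{-r}`, which the weight in `X` is designed to cancel. -/
lemma lintegral_detWeight_mul_left (A : Stiefel q r) (B : Stiefel q m) (hmr : m ≤ r)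
    {F : Matrix (Fin q) (Fin m) ℝ → ℝ≥0∞} (hF : Measurable F) (hinv : LeftInvariant F) :
    ∫⁻ X : Matrix (Fin r) (Fin m) ℝ, ∫⁻ g : Matrix (Fin m) (Fin m) ℝ,
      detWeight r X * F (A.1 * (X * g)) * ENNReal.ofReal (|g.det| ^ (r - m)) =
    (∫⁻ X : Matrix (Fin r) (Fin m) ℝ, gaussWeight X) * polarIntegral B (r - m) F := by
  rw [← lintegral_mul_const _ measurable_gaussWeight]
  refine lintegral_congr_ae ?_
  filter_upwards [ae_gramDet_ne_zero hmr] with X hX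
  set R := coordsOf X with hR
  have hRd : R.det ≠ 0 := det_coordsOf_ne_zero hX
  have hG : Measurable fun g : Matrix (Fin m) (Fin m) ℝ =>
      F (B.1 * g) * ENNReal.ofReal (|g.det| ^ (r - m)) :=
    (hF.comp (measurable_mul_const_left _)).mul (measurable_abs_det_pow _)
  have hG' : Measurable fun g : Matrix (Fin m) (Fin m) ℝ =>
      F (B.1 * (R * g)) * ENNReal.ofReal (|g.det| ^ (r - m)) :=
    ((hF.comp (measurable_mul_const_left _)).comp (measurable_mul_const_left _)).mul
      (measurable_abs_det_pow _)
  have h1 : ∀ g : Matrix (Fin m) (Fin m) ℝ, F (A.1 * (X * g)) = F (B.1 * (R * g)) := fun g => by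
    rw [← hinv.frame_mul (comp A (frameOf hX)) B]
    simp only [comp, hR, Matrix.mul_assoc]
    rw [← Matrix.mul_assoc (frameOf hX).1, frameOf_mul_coordsOf hX]
  have h2 := lintegral_mul_left R hRd hG
  simp_rw [Matrix.det_mul, abs_mul, mul_pow, ENNReal.ofReal_mul (pow_nonneg (abs_nonneg R.det) _),
    mul_left_comm (F _)] at h2
  rw [lintegral_const_mul _ hG', ← mul_assoc, ← ENNReal.ofReal_mul (by positivity), ← pow_add,
    Fintype.card_fin, Nat.add_sub_of_le hmr] at h2
  rw [polarIntegral, ← h2, ← mul_assoc, detWeight, gramDet_eq_coordsOf hX, Real.sqrt_sq_eq_abs,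
    ← lintegral_const_mul _ hG']
  refine lintegral_congr fun g => ?_
  rw [h1, mul_assoc]

/-- The same double integral, now substituting `X ↦ Xg⁻¹` first. What remains in `g` is an integral
against `|det g|^{-m} dg`, the Haar measure of `GL_m`, so `g ↦ gR` removes the dependence on `X`.
The remaining constant need not be evaluated, since it is found by testing on a Gaussian. -/
lemma lintegral_detWeight_mul_right (A : Stiefel q r) (hmr : m ≤ r)
    {F : Matrix (Fin q) (Fin m) ℝ → ℝ≥0∞} (hF : Measurable F) :
    ∫⁻ X : Matrix (Fin r) (Fin m) ℝ, ∫⁻ g : Matrix (Fin m) (Fin m) ℝ,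
      detWeight r X * F (A.1 * (X * g)) * ENNReal.ofReal (|g.det| ^ (r - m)) =
    (∫⁻ X : Matrix (Fin r) (Fin m) ℝ, F (A.1 * X)) *
      ∫⁻ g : Matrix (Fin m) (Fin m) ℝ, detWeight r g⁻¹ * (ENNReal.ofReal (|g.det| ^ m))⁻¹ := by
  have hmulc : Continuous fun p : Matrix (Fin r) (Fin m) ℝ × Matrix (Fin m) (Fin m) ℝ =>
      p.1 * p.2 := continuous_fst.matrix_mul continuous_snd
  have hmul := hmulc.measurable
  have hA : Measurable fun X : Matrix (Fin r) (Fin m) ℝ => F (A.1 * X) :=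
    hF.comp (measurable_mul_const_left _)
  have hJ : Measurable fun g : Matrix (Fin m) (Fin m) ℝ =>
      detWeight r g⁻¹ * (ENNReal.ofReal (|g.det| ^ m))⁻¹ :=
    ((measurable_detWeight r).comp measurable_matrix_inv).mul (measurable_abs_det_pow m).inv
  have hmeas₁ : Measurable fun p : Matrix (Fin r) (Fin m) ℝ × Matrix (Fin m) (Fin m) ℝ =>
      detWeight r p.1 * F (A.1 * (p.1 * p.2)) * ENNReal.ofReal (|p.2.det| ^ (r - m)) :=
    (((measurable_detWeight r).comp measurable_fst).mul (hA.comp hmul)).mul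
      ((measurable_abs_det_pow _).comp measurable_snd)
  have hmeas₂ : Measurable fun p : Matrix (Fin r) (Fin m) ℝ × Matrix (Fin m) (Fin m) ℝ =>
      detWeight r (p.1 * p.2⁻¹) * F (A.1 * p.1) * (ENNReal.ofReal (|p.2.det| ^ m))⁻¹ := by
    refine Measurable.mul (Measurable.mul ?_ (hA.comp measurable_fst))
      ((measurable_abs_det_pow _).comp measurable_snd).inv
    exact (measurable_detWeight r).comp
      (hmul.comp (measurable_fst.prodMk (measurable_matrix_inv.comp measurable_snd)))
  rw [lintegral_lintegral_swap hmeas₁.aemeasurable, ← lintegral_mul_const _ hA]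
  have key₁ : ∀ᵐ g : Matrix (Fin m) (Fin m) ℝ, ∫⁻ X : Matrix (Fin r) (Fin m) ℝ,
      detWeight r X * F (A.1 * (X * g)) * ENNReal.ofReal (|g.det| ^ (r - m)) =
      ∫⁻ X : Matrix (Fin r) (Fin m) ℝ,
        detWeight r (X * g⁻¹) * F (A.1 * X) * (ENNReal.ofReal (|g.det| ^ m))⁻¹ := by
    filter_upwards [ae_det_ne_zero] with g hg
    have hu : IsUnit g.det := isUnit_iff_ne_zero.mpr hg
    have hpos : 0 < |g.det| := abs_pos.mpr hg
    have h := lintegral_mul_right g hg (hmeas₂.comp (measurable_prodMk_right (y := g)))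
    simp only [Function.comp_def, Matrix.mul_nonsing_inv_cancel_right g _ hu] at h
    rw [← h, ← lintegral_const_mul' _ _ ENNReal.ofReal_ne_top]
    refine lintegral_congr fun X => ?_
    have e : ENNReal.ofReal (|g.det| ^ Fintype.card (Fin r)) =
        ENNReal.ofReal (|g.det| ^ (r - m)) * ENNReal.ofReal (|g.det| ^ m) := by
      rw [← ENNReal.ofReal_mul (by positivity), ← pow_add, Fintype.card_fin, Nat.sub_add_cancel hmr]
    have e2 : ENNReal.ofReal (|g.det| ^ m) * (ENNReal.ofReal (|g.det| ^ m))⁻¹ = 1 :=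
      ENNReal.mul_inv_cancel (ENNReal.ofReal_pos.mpr (pow_pos hpos m)).ne' ENNReal.ofReal_ne_top
    rw [e]
    calc _ = detWeight r X * F (A.1 * (X * g)) * ENNReal.ofReal (|g.det| ^ (r - m)) *
          (ENNReal.ofReal (|g.det| ^ m) * (ENNReal.ofReal (|g.det| ^ m))⁻¹) := by rw [e2, mul_one]
      _ = _ := by ring
  rw [lintegral_congr_ae key₁, ← lintegral_lintegral_swap hmeas₂.aemeasurable]
  refine lintegral_congr_ae ?_
  filter_upwards [ae_gramDet_ne_zero hmr] with X hX
  set R := coordsOf X with hR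
  have hRd : R.det ≠ 0 := det_coordsOf_ne_zero hX
  have hpos : 0 < |R.det| := abs_pos.mpr hRd
  have hK : Measurable fun g : Matrix (Fin m) (Fin m) ℝ =>
      detWeight r (R * g⁻¹) * (ENNReal.ofReal (|g.det| ^ m))⁻¹ :=
    ((measurable_detWeight r).comp ((measurable_mul_const_left _).comp measurable_matrix_inv)).mul
      (measurable_abs_det_pow m).inv
  have h1 : ∀ g : Matrix (Fin m) (Fin m) ℝ,
      detWeight r (X * g⁻¹) = detWeight r (R * g⁻¹) := fun g => by
    conv_lhs => rw [← frameOf_mul_coordsOf hX, Matrix.mul_assoc]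
    rw [detWeight, gaussWeight_isometry_mul (frameOf hX).2, gramDet_isometry_mul (frameOf hX).2]
    rfl
  have h2 := lintegral_mul_right R hRd hK
  simp_rw [h1, mul_comm _ (F _), mul_assoc]
  rw [lintegral_const_mul _ hK, ← h2, Fintype.card_fin,
    ← lintegral_const_mul' _ _ ENNReal.ofReal_ne_top]
  congr 1
  refine lintegral_congr fun g => ?_
  have e2 : ENNReal.ofReal (|R.det| ^ m) * (ENNReal.ofReal (|R.det| ^ m))⁻¹ = 1 :=
    ENNReal.mul_inv_cancel (ENNReal.ofReal_pos.mpr (pow_pos hpos m)).ne' ENNReal.ofReal_ne_top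
  rw [Matrix.mul_inv_rev, ← Matrix.mul_assoc, Matrix.mul_nonsing_inv _
    (isUnit_iff_ne_zero.mpr hRd), Matrix.one_mul, Matrix.det_mul, abs_mul, mul_pow,
    ENNReal.ofReal_mul (by positivity), ENNReal.mul_inv (Or.inr ENNReal.ofReal_ne_top)
      (Or.inl ENNReal.ofReal_ne_top)]
  calc _ = ENNReal.ofReal (|R.det| ^ m) * (ENNReal.ofReal (|R.det| ^ m))⁻¹ *
        (detWeight r g⁻¹ * (ENNReal.ofReal (|g.det| ^ m))⁻¹) := by ring
    _ = _ := by rw [e2, one_mul]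

end Polar

/-! ### Comparison of matrix spaces of different heights -/

section Ratio

variable {q r m : ℕ}

/-- The Gaussian moment of order `s` of the Gram determinant of an `n × m` matrix. -/
def gaussMoment (n m : ℕ) (s : ℝ) : ℝ≥0∞ :=
  ∫⁻ X : Matrix (Fin n) (Fin m) ℝ, gaussWeight X * ENNReal.ofReal (gramDet X ^ s)

/-- The value of `gaussMoment n m s`. -/
def gaussMomentValue (n m : ℕ) (s : ℝ) : ℝ :=
  Real.pi ^ ((n : ℝ) * m / 2) * ∏ j ∈ Finset.range m,
    (Real.Gamma (((n : ℝ) - j) / 2 + s) / Real.Gamma (((n : ℝ) - j) / 2))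

lemma gaussMoment_eq {n m : ℕ} {s : ℝ} (h : m ≤ n) (hs : 0 < ((n : ℝ) - m + 1) / 2 + s) :
    gaussMoment n m s = ENNReal.ofReal (gaussMomentValue n m s) :=
  lintegral_gramDet_rpow h hs

lemma gaussMomentValue_pos {n m : ℕ} {s : ℝ} (h : m ≤ n) (hs : 0 < ((n : ℝ) - m + 1) / 2 + s) :
    0 < gaussMomentValue n m s := by
  refine mul_pos (Real.rpow_pos_of_pos Real.pi_pos _) (Finset.prod_pos fun j hj => ?_)
  have hj' : (j : ℝ) + 1 ≤ m := by exact_mod_cast Finset.mem_range.mp hj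
  have hmn : (m : ℝ) ≤ n := by exact_mod_cast h
  exact div_pos (Real.Gamma_pos_of_pos (by linarith)) (Real.Gamma_pos_of_pos (by linarith))

lemma gaussMoment_ne_zero {n m : ℕ} {s : ℝ} (h : m ≤ n) (hs : 0 < ((n : ℝ) - m + 1) / 2 + s) :
    gaussMoment n m s ≠ 0 := by
  rw [gaussMoment_eq h hs]
  exact (ENNReal.ofReal_pos.mpr (gaussMomentValue_pos h hs)).ne'

lemma gaussMoment_ne_top {n m : ℕ} {s : ℝ} (h : m ≤ n) (hs : 0 < ((n : ℝ) - m + 1) / 2 + s) :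
    gaussMoment n m s ≠ ∞ := by
  rw [gaussMoment_eq h hs]
  exact ENNReal.ofReal_ne_top

lemma lintegral_gaussWeight (n m : ℕ) :
    ∫⁻ X : Matrix (Fin n) (Fin m) ℝ, gaussWeight X = gaussMoment n m 0 := by
  simp [gaussMoment]

lemma zero_order_pos {n m : ℕ} (h : m ≤ n) : 0 < ((n : ℝ) - m + 1) / 2 + 0 := by
  have hmn : (m : ℝ) ≤ n := by exact_mod_cast h
  linarith

lemma leftInvariant_gaussWeight {κ : Type*} [Fintype κ] :
    LeftInvariant (gaussWeight : Matrix (Fin q) κ ℝ → ℝ≥0∞) := fun h X =>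
  gaussWeight_isometry_mul (orthogonal_transpose_mul h) X

lemma polarIntegral_gaussWeight (B : Stiefel q m) (hmr : m ≤ r) :
    polarIntegral B (r - m) gaussWeight = gaussMoment m m (((r : ℝ) - m) / 2) := by
  refine lintegral_congr fun g => ?_
  rw [gaussWeight_isometry_mul B.2, gramDet_square, ← sq_abs, ← Real.rpow_natCast _ 2,
    ← Real.rpow_mul (abs_nonneg _), ← Real.rpow_natCast, Nat.cast_sub hmr]
  congr 3
  push_cast
  ring

/-- Two evaluations of one double integral show that both sides are proportional; the choice `F =
gaussWeight` determines the factor. -/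
lemma polar_formula (A : Stiefel q r) (B : Stiefel q m) (hmr : m ≤ r)
    {F : Matrix (Fin q) (Fin m) ℝ → ℝ≥0∞} (hF : Measurable F) (hinv : LeftInvariant F) :
    gaussMoment m m (((r : ℝ) - m) / 2) * ∫⁻ X : Matrix (Fin r) (Fin m) ℝ, F (A.1 * X) =
      gaussMoment r m 0 * polarIntegral B (r - m) F := by
  have h0 := (lintegral_detWeight_mul_left A B hmr measurable_gaussWeight
    leftInvariant_gaussWeight).symm.trans
    (lintegral_detWeight_mul_right A hmr measurable_gaussWeight)
  have h1 := (lintegral_detWeight_mul_left A B hmr hF hinv).symm.trans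
    (lintegral_detWeight_mul_right A hmr hF)
  simp_rw [gaussWeight_isometry_mul A.2] at h0
  rw [lintegral_gaussWeight, polarIntegral_gaussWeight B hmr] at h0
  rw [lintegral_gaussWeight] at h1
  rw [h1, mul_comm, (ENNReal.mul_right_inj (gaussMoment_ne_zero hmr (zero_order_pos hmr))
    (gaussMoment_ne_top hmr (zero_order_pos hmr))).mp h0]

/-- The relation between integration over `(q-k) × m` and over `q × m` matrices. -/
lemma lintegral_orbitAverage_embedding {k : ℕ} (A : Stiefel q (q - k)) (hkq : k ≤ q)
    (hm : m ≤ q - k) {F : Matrix (Fin q) (Fin m) ℝ → ℝ≥0∞} (hF : Measurable F) :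
    gaussMoment q m (-(k : ℝ) / 2) *
        ∫⁻ X : Matrix (Fin (q - k)) (Fin m) ℝ, orbitAverage F (A.1 * X) =
      gaussMoment (q - k) m 0 *
        ∫⁻ X : Matrix (Fin q) (Fin m) ℝ, F X * ENNReal.ofReal (gramDet X ^ (-(k : ℝ) / 2)) := by
  have hmq : m ≤ q := by omega
  set B : Stiefel q m := baseFrame hmq
  set K : Matrix (Fin q) (Fin m) ℝ → ℝ≥0∞ :=
    fun X => ENNReal.ofReal (gramDet X ^ (-(k : ℝ) / 2)) with hK
  have hKm : Measurable K := (measurable_gramDet.pow_const _).ennreal_ofReal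
  have hKinv : LeftInvariant K := fun h X => by
    rw [hK]
    simp only [gramDet_isometry_mul (orthogonal_transpose_mul h)]
  -- In polar form `K` is `|det g|^{-k}`, which is exactly the difference between the Jacobians
  -- `|det g|^{q-m}` and `|det g|^{q-k-m}`.
  have hpow : ∀ G : Matrix (Fin q) (Fin m) ℝ → ℝ≥0∞,
      polarIntegral B (q - m) (fun X => G X * K X) = polarIntegral B (q - k - m) G := by
    intro G
    refine lintegral_congr_ae ?_
    filter_upwards [ae_det_ne_zero] with g hg
    have hpos : 0 < |g.det| := abs_pos.mpr hg
    simp only [hK]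
    rw [gramDet_isometry_mul B.2, gramDet_square, mul_assoc, ← ENNReal.ofReal_mul (by positivity),
      ← sq_abs, ← Real.rpow_natCast _ 2, ← Real.rpow_mul hpos.le, ← Real.rpow_natCast,
      ← Real.rpow_natCast, ← Real.rpow_add hpos, Nat.cast_sub hmq, Nat.cast_sub hm,
      Nat.cast_sub hkq]
    congr 3
    push_cast
    ring
  have hG : ∀ {G : Matrix (Fin q) (Fin m) ℝ → ℝ≥0∞}, Measurable G → LeftInvariant G →
      gaussMoment m m (((q : ℝ) - m) / 2) * ∫⁻ X, G X * K X =
        gaussMoment q m 0 * polarIntegral B (q - k - m) G := by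
    intro G hGm hGi
    have hGK : Measurable fun X => G X * K X := hGm.mul hKm
    have h := polar_formula (⟨1, by simp⟩ : Stiefel q q) B hmq hGK
      (fun h X => by rw [hGi h X, hKinv h X])
    simp only [Matrix.one_mul] at h
    rw [h, hpow]
  have hs : 0 < ((m : ℝ) - m + 1) / 2 + (((q - k : ℕ) : ℝ) - m) / 2 := by
    have : (m : ℝ) ≤ ((q - k : ℕ) : ℝ) := by exact_mod_cast hm
    linarith
  have hs' : 0 < ((m : ℝ) - m + 1) / 2 + ((q : ℝ) - m) / 2 := by
    have : (m : ℝ) ≤ q := by exact_mod_cast hmq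
    linarith
  have hFa := measurable_orbitAverage hF
  have hFi : LeftInvariant (orbitAverage F) := fun g X => orbitAverage_act F g X
  have e1 := polar_formula A B hm hFa hFi
  have e2 := hG hFa hFi
  rw [lintegral_orbitAverage_mul hF hKm hKinv] at e2
  -- The Gaussian test function relates the constants of the two polar formulas, in heights `q` and
  -- `q - k`.
  have e3 := hG measurable_gaussWeight leftInvariant_gaussWeight
  rw [polarIntegral_gaussWeight B hm] at e3
  change _ * gaussMoment q m (-(k : ℝ) / 2) = _ at e3
  refine (ENNReal.mul_right_inj (gaussMoment_ne_zero le_rfl hs')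
    (gaussMoment_ne_top le_rfl hs')).mp ?_
  rw [← mul_assoc, e3, mul_assoc, e1, mul_left_comm, ← e2]
  ring

end Ratio

/-! ### Density of the random frame -/

section Density

variable {n m k : ℕ}

/-- The index equivalence `Fin m ⊕ Fin (n - m - k) ≃ Fin (n - k)`. -/
def fibreEquiv (h : m + k ≤ n) : Fin m ⊕ Fin (n - m - k) ≃ Fin (n - k) :=
  finSumFinEquiv.trans (finCongr (by omega))

/-- The frame `[v, cγA]` of the orthogonal complement of `cγA₀`, where `A` is a complementary frame
of `A₀`. -/
def rotatedFrame (h : m + k ≤ n) (v : Stiefel n m) (c : Stiefel n (n - m)) (hc : v.1ᵀ * c.1 = 0)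
    (A : Stiefel (n - m) (n - m - k)) (g : orthogonalGroup (Fin (n - m)) ℝ) : Stiefel n (n - k) :=
  ⟨(fromCols v.1 (c.1 * (g.1 * A.1))).submatrix id (fibreEquiv h).symm, by
    have h1 : (comp c (act g A)).1ᵀ * (comp c (act g A)).1 = 1 := (comp c (act g A)).2
    have h2 : v.1ᵀ * (comp c (act g A)).1 = 0 := by
      simp [comp, ← Matrix.mul_assoc, hc]
    have h3 : (comp c (act g A)).1ᵀ * v.1 = 0 := by
      have h := congrArg Matrix.transpose h2
      rwa [Matrix.transpose_mul, Matrix.transpose_transpose, Matrix.transpose_zero] at h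
    change ((fromCols v.1 (comp c (act g A)).1).submatrix id (fibreEquiv h).symm)ᵀ *
      (fromCols v.1 (comp c (act g A)).1).submatrix id (fibreEquiv h).symm = 1
    rw [Matrix.transpose_submatrix, ← Matrix.submatrix_mul _ _ _ _ _ Function.bijective_id,
      Matrix.transpose_fromCols, Matrix.fromRows_mul_fromCols, v.2, h1, h2, h3,
      Matrix.fromBlocks_one, Matrix.submatrix_one_equiv]⟩

lemma rotatedFrame_mul (h : m + k ≤ n) (v : Stiefel n m) (c : Stiefel n (n - m))
    (hc : v.1ᵀ * c.1 = 0) (A : Stiefel (n - m) (n - m - k)) (g : orthogonalGroup (Fin (n - m)) ℝ)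
    {κ : Type*} (Y : Matrix (Fin (n - k)) κ ℝ) :
    (rotatedFrame h v c hc A g).1 * Y =
      fromCols v.1 (c.1 * (g.1 * A.1)) * Y.submatrix (fibreEquiv h) id := by
  ext i j
  simp only [rotatedFrame, Matrix.mul_apply, Matrix.submatrix_apply, id]
  exact (Fintype.sum_equiv (fibreEquiv h) _ _ (by simp)).symm

lemma continuous_rotatedFrame (h : m + k ≤ n) (v : Stiefel n m) (c : Stiefel n (n - m))
    (hc : v.1ᵀ * c.1 = 0) (A : Stiefel (n - m) (n - m - k)) :
    Continuous fun g => (rotatedFrame h v c hc A g).1 := by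
  refine Continuous.matrix_submatrix ?_ _ _
  have h1 : Continuous fun g : orthogonalGroup (Fin (n - m)) ℝ => c.1 * (g.1 * A.1) :=
    continuous_const.matrix_mul (continuous_subtype_val.matrix_mul continuous_const)
  refine continuous_matrix fun i j => ?_
  rcases j with j | j
  · exact continuous_const
  · exact h1.matrix_elem i j

/-- Since `cc' = I - vv'`, the matrix `I - w'vv'w` is the Gram matrix of the component of `w`
orthogonal to `v`. -/
lemma sineKernel_eq (v w : Stiefel n m) (c : Stiefel n (n - m)) (hc : v.1ᵀ * c.1 = 0) :
    sineKernel n m ((n : ℝ) - k - m) v w = gramDet (c.1ᵀ * w.1) ^ (-(k : ℝ) / 2) := by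
  have h := mul_transpose_complFrame v c hc
  have h1 : gramDet (c.1ᵀ * w.1) = (1 - w.1ᵀ * v.1 * v.1ᵀ * w.1).det := by
    have e : c.1 * c.1ᵀ = 1 - v.1 * v.1ᵀ := by rw [← h]; abel
    rw [gramDet, Matrix.transpose_mul, Matrix.transpose_transpose, Matrix.mul_assoc,
      ← Matrix.mul_assoc c.1, e, Matrix.sub_mul, Matrix.mul_sub, Matrix.one_mul, w.2]
    simp only [Matrix.mul_assoc]
  rw [sineKernel, ← h1, abs_of_nonneg (gramDet_nonneg _)]
  congr 1
  ring

/-- The uniform `ω` is realized as the orthonormalization of a Gaussian matrix. Equivariance moves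
the frame inside, and the row blocks of the Gaussian matrix become `G` and `H`. -/
lemma lintegral_rotatedFrame_coords (hm : m ≤ n - k) (h : m + k ≤ n) (v : Stiefel n m)
    (c : Stiefel n (n - m)) (hc : v.1ᵀ * c.1 = 0) (A : Stiefel (n - m) (n - m - k))
    (g : orthogonalGroup (Fin (n - m)) ℝ) {F : Matrix (Fin n) (Fin m) ℝ → ℝ≥0∞}
    (hF : Measurable F) :
    (∫⁻ ω, F ((rotatedFrame h v c hc A g).1 * ω.1) ∂stiefelMeasure (n - k) m) *
      gaussMoment (n - k) m 0 = ∫⁻ G : Matrix (Fin m) (Fin m) ℝ,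
        ∫⁻ H : Matrix (Fin (n - m - k)) (Fin m) ℝ,
          F (orthonormalize (v.1 * G + c.1 * (g.1 * (A.1 * H)))) *
            gaussWeight (v.1 * G + c.1 * (g.1 * (A.1 * H))) := by
  set Ψ : Matrix (Fin n) (Fin m) ℝ → ℝ≥0∞ := fun X => F (orthonormalize X) * gaussWeight X with hΨ
  have hΨm : Measurable Ψ := (hF.comp measurable_orthonormalize).mul measurable_gaussWeight
  have hW : Measurable fun X : Matrix (Fin (n - k)) (Fin m) ℝ =>
      F ((rotatedFrame h v c hc A g).1 * X) := hF.comp (measurable_mul_const_left _)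
  have hW' : Measurable fun X : Matrix (Fin m ⊕ Fin (n - m - k)) (Fin m) ℝ =>
      Ψ (fromCols v.1 (c.1 * (g.1 * A.1)) * X) := hΨm.comp (measurable_mul_const_left _)
  have e := lintegral_orthonormalize hm hW measurable_gaussWeight leftInvariant_gaussWeight
  rw [lintegral_gaussWeight] at e
  have e2 : ∀ Y : Matrix (Fin (n - k)) (Fin m) ℝ,
      F ((rotatedFrame h v c hc A g).1 * orthonormalize Y) * gaussWeight Y =
        Ψ (fromCols v.1 (c.1 * (g.1 * A.1)) * Y.submatrix (fibreEquiv h) id) := fun Y => by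
    rw [← rotatedFrame_mul h v c hc, hΨ]
    simp only
    rw [orthonormalize_isometry_mul (rotatedFrame h v c hc A g).2,
      gaussWeight_isometry_mul (rotatedFrame h v c hc A g).2]
  have e3 := lintegral_submatrix_equiv (fibreEquiv h) hW'
  rw [lintegral_fromRows hW'] at e3
  refine e.symm.trans ((lintegral_congr e2).trans (e3.trans ?_))
  simp_rw [Matrix.fromCols_mul_fromRows, Matrix.mul_assoc]
  rfl

lemma lintegral_haarO_swap {q r : ℕ} (v : Stiefel n m) (c : Stiefel n q) (A : Stiefel q r)
    {Ψ : Matrix (Fin n) (Fin m) ℝ → ℝ≥0∞} (hΨ : Measurable Ψ) :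
    ∫⁻ g, (∫⁻ G : Matrix (Fin m) (Fin m) ℝ, ∫⁻ H : Matrix (Fin r) (Fin m) ℝ,
        Ψ (v.1 * G + c.1 * (g.1 * (A.1 * H)))) ∂haarO q =
      ∫⁻ G : Matrix (Fin m) (Fin m) ℝ, ∫⁻ H : Matrix (Fin r) (Fin m) ℝ,
        orbitAverage (fun Y => Ψ (v.1 * G + c.1 * Y)) (A.1 * H) := by
  have hV : Measurable fun p : (orthogonalGroup (Fin q) ℝ × Matrix (Fin m) (Fin m) ℝ) ×
      Matrix (Fin r) (Fin m) ℝ => v.1 * p.1.2 + c.1 * (p.1.1.1 * (A.1 * p.2)) := by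
    refine Continuous.measurable (Continuous.add ?_ ?_)
    · exact continuous_const.matrix_mul (continuous_snd.comp continuous_fst)
    · exact continuous_const.matrix_mul ((continuous_subtype_val.comp
        (continuous_fst.comp continuous_fst)).matrix_mul
          (continuous_const.matrix_mul continuous_snd))
  have hm3 := hΨ.comp hV
  have hm2 := hm3.lintegral_prod_right' (ν := (volume : Measure (Matrix (Fin r) (Fin m) ℝ)))
  have e := lintegral_lintegral_swap (μ := haarO q)
    (ν := (volume : Measure (Matrix (Fin m) (Fin m) ℝ))) (f := fun g G =>
      ∫⁻ H : Matrix (Fin r) (Fin m) ℝ, Ψ (v.1 * G + c.1 * (g.1 * (A.1 * H)))) hm2.aemeasurable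
  refine e.trans (lintegral_congr fun G => ?_)
  have hG : Measurable fun p : orthogonalGroup (Fin q) ℝ × Matrix (Fin r) (Fin m) ℝ =>
      Ψ (v.1 * G + c.1 * (p.1.1 * (A.1 * p.2))) :=
    hm3.comp (measurable_fst.prodMk measurable_const |>.prodMk measurable_snd)
  exact lintegral_lintegral_swap (μ := haarO q)
    (ν := (volume : Measure (Matrix (Fin r) (Fin m) ℝ))) (f := fun g H =>
      Ψ (v.1 * G + c.1 * (g.1 * (A.1 * H)))) hG.aemeasurable

/-- The law of the random frame `[v, cγA]ω` has density a constant times the sine kernel. -/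
lemma lintegral_rotatedFrame (h : 2 * m + k ≤ n) (h' : m + k ≤ n) (v : Stiefel n m)
    (c : Stiefel n (n - m)) (hc : v.1ᵀ * c.1 = 0) (A : Stiefel (n - m) (n - m - k))
    {F : Matrix (Fin n) (Fin m) ℝ → ℝ≥0∞} (hF : Measurable F) :
    gaussMoment (n - m) m (-(k : ℝ) / 2) * gaussMoment (n - k) m 0 *
      ∫⁻ g, ∫⁻ ω, F ((rotatedFrame h' v c hc A g).1 * ω.1) ∂stiefelMeasure (n - k) m
        ∂haarO (n - m) =
    gaussMoment (n - m - k) m 0 * gaussMoment n m (-(k : ℝ) / 2) *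
      ∫⁻ w, F w.1 * ENNReal.ofReal (sineKernel n m ((n : ℝ) - k - m) v w)
        ∂stiefelMeasure n m := by
  set Ψ : Matrix (Fin n) (Fin m) ℝ → ℝ≥0∞ := fun X => F (orthonormalize X) * gaussWeight X with hΨ
  have hΨm : Measurable Ψ := (hF.comp measurable_orthonormalize).mul measurable_gaussWeight
  -- Pass to Gaussian coordinates and integrate over the rotation first; it acts only on the
  -- component orthogonal to `v`.
  have step₂ : gaussMoment (n - k) m 0 *
      ∫⁻ g, ∫⁻ ω, F ((rotatedFrame h' v c hc A g).1 * ω.1) ∂stiefelMeasure (n - k) m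
        ∂haarO (n - m) =
      ∫⁻ G : Matrix (Fin m) (Fin m) ℝ, ∫⁻ H : Matrix (Fin (n - m - k)) (Fin m) ℝ,
        orbitAverage (fun Y => Ψ (v.1 * G + c.1 * Y)) (A.1 * H) := by
    rw [← lintegral_const_mul' _ _ (gaussMoment_ne_top (by omega) (zero_order_pos (by omega))),
      ← lintegral_haarO_swap v c A hΨm]
    refine lintegral_congr fun g => ?_
    rw [mul_comm, lintegral_rotatedFrame_coords (by omega) h' v c hc A g hF]
  have hct : c.1ᵀ * v.1 = 0 := by
    have h := congrArg Matrix.transpose hc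
    rwa [Matrix.transpose_mul, Matrix.transpose_transpose, Matrix.transpose_zero] at h
  set K : Matrix (Fin n) (Fin m) ℝ → ℝ≥0∞ :=
    fun X => ENNReal.ofReal (gramDet (c.1ᵀ * X) ^ (-(k : ℝ) / 2)) with hK
  have hKm : Measurable K := ((measurable_gramDet.comp
    (measurable_mul_const_left c.1ᵀ)).pow_const _).ennreal_ofReal
  -- Convergence of the moment of order `-k/2` amounts to `2m + k < n + 1`.
  have hs : 0 < (((n - m : ℕ) : ℝ) - m + 1) / 2 + -(k : ℝ) / 2 := by
    have : 2 * (m : ℝ) + k ≤ n := by exact_mod_cast h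
    rw [Nat.cast_sub (by omega)]
    linarith
  have hv : ∀ G : Matrix (Fin m) (Fin m) ℝ, Measurable fun H : Matrix (Fin (n - m)) (Fin m) ℝ =>
      v.1 * G + c.1 * H := fun G => (measurable_mul_const_left c.1).const_add _
  have hΨK : Measurable fun X => Ψ X * K X := hΨm.mul hKm
  have hFK : Measurable fun X => F X * K X := hF.mul hKm
  -- For fixed `G`, the averaged `H` integral becomes an integral over all `(n-m) × m` matrices,
  -- weighted by a power of the Gram determinant of `c'X`.
  have step₃ : gaussMoment (n - m) m (-(k : ℝ) / 2) *
      ∫⁻ G : Matrix (Fin m) (Fin m) ℝ, ∫⁻ H : Matrix (Fin (n - m - k)) (Fin m) ℝ,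
        orbitAverage (fun Y => Ψ (v.1 * G + c.1 * Y)) (A.1 * H) =
      gaussMoment (n - m - k) m 0 * ∫⁻ X, Ψ X * K X := by
    rw [← lintegral_const_mul' _ _ (gaussMoment_ne_top (by omega) hs),
      lintegral_frame_coords v c hc hΨK, ← lintegral_const_mul' _ _
        (gaussMoment_ne_top (by omega) (zero_order_pos (by omega)))]
    refine lintegral_congr fun G => ?_
    have hΨG : Measurable fun H : Matrix (Fin (n - m)) (Fin m) ℝ => Ψ (v.1 * G + c.1 * H) :=
      hΨm.comp (hv G)
    rw [lintegral_orbitAverage_embedding A (by omega) (by omega) hΨG]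
    congr 1
    refine lintegral_congr fun H => ?_
    simp only [hK, Matrix.mul_add, ← Matrix.mul_assoc, hct, c.2]
    simp
  have step₄ : ∫⁻ X, Ψ X * K X = gaussMoment n m (-(k : ℝ) / 2) *
      ∫⁻ w, F w.1 * ENNReal.ofReal (sineKernel n m ((n : ℝ) - k - m) v w)
        ∂stiefelMeasure n m := by
    have e := lintegral_orthonormalize (show m ≤ n by omega) hFK
      (φ := fun X => gaussWeight X * ENNReal.ofReal (gramDet X ^ (-(k : ℝ) / 2)))
      (measurable_gaussWeight.mul (measurable_gramDet.pow_const _).ennreal_ofReal)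
      (fun g X => by
        simp only [gaussWeight_isometry_mul (orthogonal_transpose_mul g),
          gramDet_isometry_mul (orthogonal_transpose_mul g)])
    simp_rw [sineKernel_eq v _ c hc]
    rw [mul_comm]
    refine Eq.trans ?_ e
    refine lintegral_congr_ae ?_
    filter_upwards [ae_gramDet_ne_zero (show m ≤ n by omega)] with X hX
    -- The singular weight splits into a function of the frame and a function of the Gram matrix, as
    -- the independence statement requires.
    have e2 : gramDet (c.1ᵀ * X) = gramDet (c.1ᵀ * orthonormalize X) * gramDet X := by
      conv_lhs => rw [← frameOf_mul_coordsOf hX, ← Matrix.mul_assoc, gramDet_mul_square,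
        ← gramDet_eq_coordsOf hX]
      rfl
    simp only [hΨ, hK]
    rw [e2, Real.mul_rpow (gramDet_nonneg _) (gramDet_nonneg _),
      ENNReal.ofReal_mul (Real.rpow_nonneg (gramDet_nonneg _) _)]
    ring
  rw [mul_assoc, step₂, step₃, step₄, mul_assoc]

end Density

/-! ### The constant -/

section Constant

/-- The constant in the factorization of the sine transform. -/
def funkConstant (n m k : ℕ) : ℝ :=
  siegelGamma m (((n : ℝ) - m) / 2) * siegelGamma m (((n : ℝ) - k) / 2) /
    (siegelGamma m ((n : ℝ) / 2) * siegelGamma m (((n : ℝ) - k - m) / 2))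

lemma siegelGamma_pos {m : ℕ} {a : ℝ} (h : (m : ℝ) - 1 < 2 * a) : 0 < siegelGamma m a := by
  refine mul_pos (Real.rpow_pos_of_pos Real.pi_pos _) (Finset.prod_pos fun j hj => ?_)
  have hj' : (j : ℝ) + 1 ≤ m := by exact_mod_cast Finset.mem_range.mp hj
  exact Real.Gamma_pos_of_pos (by linarith)

lemma gaussMomentValue_eq (n m : ℕ) (s : ℝ) :
    gaussMomentValue n m s =
      Real.pi ^ ((n : ℝ) * m / 2) * (siegelGamma m (n / 2 + s) / siegelGamma m (n / 2)) := by
  have hpi : Real.pi ^ ((m : ℝ) * (m - 1) / 4) ≠ 0 := (Real.rpow_pos_of_pos Real.pi_pos _).ne'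
  unfold gaussMomentValue siegelGamma
  rw [mul_div_mul_left _ _ hpi, Finset.prod_div_distrib]
  have e1 : ∀ j : ℕ, ((n : ℝ) - j) / 2 + s = n / 2 + s - j / 2 := fun j => by ring
  have e2 : ∀ j : ℕ, ((n : ℝ) - j) / 2 = n / 2 - j / 2 := fun j => by ring
  simp_rw [e1, e2]

variable {n m k : ℕ}

lemma funkConstant_pos (h : 2 * m + k ≤ n) : 0 < funkConstant n m k := by
  have h' : 2 * (m : ℝ) + k ≤ n := by exact_mod_cast h
  have hk : (0 : ℝ) ≤ k := Nat.cast_nonneg k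
  have hm : (0 : ℝ) ≤ m := Nat.cast_nonneg m
  exact div_pos (mul_pos (siegelGamma_pos (by linarith)) (siegelGamma_pos (by linarith)))
    (mul_pos (siegelGamma_pos (by linarith)) (siegelGamma_pos (by linarith)))

/-- The powers of `π` balance because `(n-m-k) + n = (n-m) + (n-k)`. The moments of order zero
contribute no Gamma quotient, so only the two moments of order `-k/2` produce the constant. -/
lemma funkConstant_mul (h : 2 * m + k ≤ n) :
    gaussMomentValue (n - m - k) m 0 * gaussMomentValue n m (-(k : ℝ) / 2) =
      gaussMomentValue (n - m) m (-(k : ℝ) / 2) * gaussMomentValue (n - k) m 0 *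
        funkConstant n m k := by
  have h' : 2 * (m : ℝ) + k ≤ n := by exact_mod_cast h
  have hk : (0 : ℝ) ≤ k := Nat.cast_nonneg k
  have hm : (0 : ℝ) ≤ m := Nat.cast_nonneg m
  have e1 : ((n - m - k : ℕ) : ℝ) = n - m - k := by
    rw [Nat.cast_sub (by omega), Nat.cast_sub (by omega)]
  have e2 : ((n - m : ℕ) : ℝ) = n - m := Nat.cast_sub (by omega)
  have e3 : ((n - k : ℕ) : ℝ) = n - k := Nat.cast_sub (by omega)
  simp only [gaussMomentValue_eq, e1, e2, e3, add_zero, funkConstant]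
  have g1 : 0 < siegelGamma m (((n : ℝ) - m) / 2) := siegelGamma_pos (by linarith)
  have g2 : 0 < siegelGamma m (((n : ℝ) - k) / 2) := siegelGamma_pos (by linarith)
  have g3 : 0 < siegelGamma m ((n : ℝ) / 2) := siegelGamma_pos (by linarith)
  have g4 : 0 < siegelGamma m (((n : ℝ) - k - m) / 2) := siegelGamma_pos (by linarith)
  have a1 : ((n : ℝ) - m - k) / 2 = ((n : ℝ) - k - m) / 2 := by ring
  have a2 : (n : ℝ) / 2 + -(k : ℝ) / 2 = ((n : ℝ) - k) / 2 := by ring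
  have a3 : ((n : ℝ) - m) / 2 + -(k : ℝ) / 2 = ((n : ℝ) - k - m) / 2 := by ring
  have hpi : Real.pi ^ (((n : ℝ) - m - k) * m / 2) * Real.pi ^ ((n : ℝ) * m / 2) =
      Real.pi ^ (((n : ℝ) - m) * m / 2) * Real.pi ^ (((n : ℝ) - k) * m / 2) := by
    rw [← Real.rpow_add Real.pi_pos, ← Real.rpow_add Real.pi_pos]
    congr 1; ring
  rw [a1, a2, a3, div_self g4.ne', div_self g2.ne', mul_one, mul_one, ← mul_assoc, hpi]
  field_simp

end Constant

/-! ### The law of a random element of a random fibre -/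

section Law

variable {n m k : ℕ}

instance instIsFiniteMeasureStiefel : IsFiniteMeasure (stiefelMeasure n m) := by
  by_cases h : m ≤ n
  · have := isProbabilityMeasure_stiefelMeasure h
    infer_instance
  · rw [stiefelMeasure, dif_neg h]
    infer_instance

instance instPolishSpaceOrthogonal : PolishSpace (orthogonalGroup (Fin n) ℝ) :=
  IsClosed.polishSpace (s := (orthogonalGroup (Fin n) ℝ : Set (Matrix (Fin n) (Fin n) ℝ)))
    isClosed_unitary

lemma isClosed_stiefel : IsClosed {v : Matrix (Fin n) (Fin m) ℝ | vᵀ * v = 1} :=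
  isClosed_eq continuous_gram continuous_const

instance instSecondCountableStiefel : SecondCountableTopology (Stiefel n m) :=
  TopologicalSpace.Subtype.secondCountableTopology _

lemma measurableEmbedding_stiefel :
    MeasurableEmbedding (Subtype.val : Stiefel n m → Matrix (Fin n) (Fin m) ℝ) := by
  have hc : Topology.IsClosedEmbedding (Subtype.val : Stiefel n m → Matrix (Fin n) (Fin m) ℝ) :=
    isClosed_stiefel.isClosedEmbedding_subtypeVal
  exact hc.measurableEmbedding

lemma continuous_comp {p : ℕ} : Continuous fun x : Stiefel n p × Stiefel p m => comp x.1 x.2 :=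
  Continuous.subtype_mk ((continuous_subtype_val.comp continuous_fst).matrix_mul
    (continuous_subtype_val.comp continuous_snd)) _

lemma measurable_comp_right {p : ℕ} (w : Stiefel n p) :
    Measurable fun ω : Stiefel p m => comp w ω :=
  (continuous_comp.comp (Continuous.prodMk_right w)).measurable

lemma map_fibre (u : Stiefel n k) (w : Stiefel n (n - k)) (hw : u.1ᵀ * w.1 = 0) :
    (stiefelMeasure (n - k) m).map (fibre u) = (stiefelMeasure (n - k) m).map (comp w) := by
  have hu : Measurable (fibre u : Stiefel (n - k) m → Stiefel n m) := measurable_comp_right _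
  have hw' : Measurable (comp w : Stiefel (n - k) m → Stiefel n m) := measurable_comp_right _
  refine Measure.ext fun S hS => ?_
  have h := integral_fibre (m := m) (S.indicator (1 : Stiefel n m → ℝ)) u w hw
  rw [← integral_map hu.aemeasurable (stronglyMeasurable_one.indicator hS).aestronglyMeasurable,
    ← integral_map hw'.aemeasurable (stronglyMeasurable_one.indicator hS).aestronglyMeasurable,
    integral_indicator_one hS, integral_indicator_one hS] at h
  exact (measureReal_eq_measureReal_iff).mp h

lemma continuous_sineKernel_base :
    Continuous fun x : Stiefel n m × Stiefel n m =>
      |(1 - x.2.1ᵀ * x.1.1 * x.1.1ᵀ * x.2.1).det| := by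
  have h1 : Continuous fun x : Stiefel n m × Stiefel n m => x.1.1 :=
    continuous_subtype_val.comp continuous_fst
  have h2 : Continuous fun x : Stiefel n m × Stiefel n m => x.2.1 :=
    continuous_subtype_val.comp continuous_snd
  exact (continuous_const.sub (((h2.matrix_transpose.matrix_mul h1).matrix_mul
    h1.matrix_transpose).matrix_mul h2)).matrix_det.abs

lemma measurable_sineKernel (α : ℝ) :
    Measurable fun x : Stiefel n m × Stiefel n m => sineKernel n m α x.1 x.2 :=
  continuous_sineKernel_base.measurable.pow_const _

lemma measurable_sineKernel_right (α : ℝ) (v : Stiefel n m) :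
    Measurable fun w => sineKernel n m α v w := by
  have h : Measurable fun w : Stiefel n m => (v, w) := measurable_prodMk_left
  have h2 := (measurable_sineKernel α).comp h
  exact h2

lemma sineKernel_nonneg (α : ℝ) (v w : Stiefel n m) : 0 ≤ sineKernel n m α v w :=
  Real.rpow_nonneg (abs_nonneg _) _

/-- By Sylvester's identity `det(I - PQ) = det(I - QP)`. The symmetry lets the mass of the density
be computed in either variable. -/
lemma sineKernel_comm (α : ℝ) (v w : Stiefel n m) :
    sineKernel n m α v w = sineKernel n m α w v := by
  unfold sineKernel
  rw [Matrix.mul_assoc, Matrix.det_one_sub_mul_comm, ← Matrix.mul_assoc]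

variable (h : m + k ≤ n) (v : Stiefel n m)

/-- A frame of the orthogonal complement of the frame `complFrame v * (g * A₀)` of the fibre
over `v`, where `A₀` is the frame of the first coordinate vectors. -/
def fibreFrame (g : orthogonalGroup (Fin (n - m)) ℝ) : Stiefel n (n - k) :=
  rotatedFrame h v (complFrame v) (complFrame_spec v)
    (complFrame (baseFrame (show k ≤ n - m by omega))) g

/-- The frame `complFrame u` is an arbitrary choice with no known regularity in `u`. This one varies
continuously with `g` and gives the same fibre integrals, so measurability arguments run through it.
-/
lemma continuous_fibreFrame : Continuous (fibreFrame h v) :=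
  Continuous.subtype_mk (continuous_rotatedFrame h v (complFrame v) (complFrame_spec v)
    (complFrame (baseFrame (show k ≤ n - m by omega)))) fun g => (fibreFrame h v g).2

lemma transpose_mul_fibreFrame (g : orthogonalGroup (Fin (n - m)) ℝ) :
    (fibre v (act g (baseFrame (show k ≤ n - m by omega)))).1ᵀ * (fibreFrame h v g).1 = 0 := by
  set A₀ : Stiefel (n - m) k := baseFrame (show k ≤ n - m by omega) with hA₀
  have h1 : (complFrame v).1ᵀ * v.1 = 0 := by
    have h := congrArg Matrix.transpose (complFrame_spec v)
    rwa [Matrix.transpose_mul, Matrix.transpose_transpose, Matrix.transpose_zero] at h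
  have h2 : ((complFrame v).1 * (g.1 * A₀.1))ᵀ *
      fromCols v.1 ((complFrame v).1 * (g.1 * (complFrame A₀).1)) = 0 := by
    rw [Matrix.mul_fromCols]
    have e1 : ((complFrame v).1 * (g.1 * A₀.1))ᵀ * v.1 = 0 := by
      rw [Matrix.transpose_mul, Matrix.mul_assoc, h1, Matrix.mul_zero]
    have e2 : ((complFrame v).1 * (g.1 * A₀.1))ᵀ *
        ((complFrame v).1 * (g.1 * (complFrame A₀).1)) = 0 := by
      rw [Matrix.transpose_mul, Matrix.mul_assoc, ← Matrix.mul_assoc (complFrame v).1ᵀ,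
        (complFrame v).2, Matrix.one_mul, Matrix.transpose_mul, Matrix.mul_assoc,
        ← Matrix.mul_assoc g.1ᵀ, orthogonal_transpose_mul, Matrix.one_mul, complFrame_spec]
    rw [e1, e2, Matrix.fromCols_zero]
  change ((complFrame v).1 * (g.1 * A₀.1))ᵀ *
      (fromCols v.1 ((complFrame v).1 * (g.1 * (complFrame A₀).1))).submatrix id
        (fibreEquiv h).symm = 0
  ext i j
  exact congrFun (congrFun h2 i) ((fibreEquiv h).symm j)

/-- The law of `ũω`, where `u` is a random element of the fibre over `v` and `ω` is random. -/
def fibreLaw : Measure (Stiefel n m) :=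
  ((haarO (n - m)).prod (stiefelMeasure (n - k) m)).map fun x => comp (fibreFrame h v x.1) x.2

lemma measurable_comp_fibreFrame :
    Measurable fun x : orthogonalGroup (Fin (n - m)) ℝ × Stiefel (n - k) m =>
      comp (fibreFrame h v x.1) x.2 :=
  (continuous_comp.comp (((continuous_fibreFrame h v).comp continuous_fst).prodMk
    continuous_snd)).measurable

lemma lintegral_fibreLaw {φ : Stiefel n m → ℝ≥0∞} (hφ : Measurable φ) :
    ∫⁻ w, φ w ∂fibreLaw h v = ∫⁻ g, ∫⁻ ω, φ (comp (fibreFrame h v g) ω)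
      ∂stiefelMeasure (n - k) m ∂haarO (n - m) := by
  rw [fibreLaw, lintegral_map hφ (measurable_comp_fibreFrame h v)]
  exact lintegral_prod _ (hφ.comp (measurable_comp_fibreFrame h v)).aemeasurable

lemma fibreLaw_eq (h₂ : 2 * m + k ≤ n) :
    fibreLaw h v = (stiefelMeasure n m).withDensity fun w =>
      ENNReal.ofReal (funkConstant n m k * sineKernel n m ((n : ℝ) - k - m) v w) := by
  have hKm := measurable_sineKernel_right ((n : ℝ) - k - m) v
  have hs₁ : 0 < (((n - m : ℕ) : ℝ) - m + 1) / 2 + -(k : ℝ) / 2 := by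
    have : 2 * (m : ℝ) + k ≤ n := by exact_mod_cast h₂
    rw [Nat.cast_sub (by omega)]
    linarith
  have hs₂ : 0 < ((n : ℝ) - m + 1) / 2 + -(k : ℝ) / 2 := by
    have : (m : ℝ) + k ≤ n := by exact_mod_cast h
    linarith
  have hC := (funkConstant_pos h₂).le
  refine Measure.ext_of_lintegral _ fun φ hφ => ?_
  rw [lintegral_withDensity_eq_lintegral_mul _ (hKm.const_mul _).ennreal_ofReal hφ,
    lintegral_fibreLaw h v hφ]
  -- The density formula concerns functions of matrices; extension by zero is measurable because the
  -- Stiefel manifold is closed.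
  set F : Matrix (Fin n) (Fin m) ℝ → ℝ≥0∞ := Function.extend Subtype.val φ 0 with hFdef
  have hF : Measurable F := measurableEmbedding_stiefel.measurable_extend hφ measurable_zero
  have hFφ : ∀ w : Stiefel n m, F w.1 = φ w := fun w => Subtype.val_injective.extend_apply _ _ _
  have key := lintegral_rotatedFrame h₂ h v (complFrame v) (complFrame_spec v)
    (complFrame (baseFrame (show k ≤ n - m by omega))) hF
  have e1 : ∀ g (ω : Stiefel (n - k) m), F ((rotatedFrame h v (complFrame v) (complFrame_spec v)
      (complFrame (baseFrame (show k ≤ n - m by omega))) g).1 * ω.1) =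
      φ (comp (fibreFrame h v g) ω) := fun g ω => hFφ (comp (fibreFrame h v g) ω)
  simp_rw [e1, hFφ] at key
  have p₁ := gaussMomentValue_pos (show m ≤ n - m by omega) hs₁
  have p₂ := gaussMomentValue_pos (show m ≤ n - k by omega) (zero_order_pos (by omega))
  have p₃ := gaussMomentValue_pos (show m ≤ n - m - k by omega) (zero_order_pos (by omega))
  rw [gaussMoment_eq (by omega) hs₁, gaussMoment_eq (by omega) (zero_order_pos (by omega)),
    gaussMoment_eq (by omega) (zero_order_pos (by omega)), gaussMoment_eq (by omega) hs₂,
    ← ENNReal.ofReal_mul p₁.le, ← ENNReal.ofReal_mul p₃.le, funkConstant_mul h₂,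
    ENNReal.ofReal_mul (mul_pos p₁ p₂).le, mul_assoc, ENNReal.mul_right_inj
      (ENNReal.ofReal_pos.mpr (mul_pos p₁ p₂)).ne' ENNReal.ofReal_ne_top,
    ← lintegral_const_mul' _ _ ENNReal.ofReal_ne_top] at key
  rw [key]
  refine lintegral_congr fun w => ?_
  rw [Pi.mul_apply, ENNReal.ofReal_mul hC]
  ring

lemma measurable_act_base (hk : k ≤ n) :
    Measurable fun g : orthogonalGroup (Fin n) ℝ => act g (baseFrame hk) :=
  (continuous_act_left _).measurable

lemma surjective_act_base (hk : k ≤ n) :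
    Function.Surjective fun g : orthogonalGroup (Fin n) ℝ => act g (baseFrame hk) := fun w => by
  obtain ⟨g, hg⟩ := exists_act_eq (baseFrame hk) w
  exact ⟨g, Subtype.ext hg⟩

/-- The orbit map is a surjective Borel map from a Polish space, so sets with Borel preimage are
Borel. Thus measurability in `u` may be tested on the group, where the continuous frame is
available. -/
lemma measurable_iff_act_base {β : Type*} [MeasurableSpace β] (hk : k ≤ n)
    {G : Stiefel n k → β} :
    Measurable G ↔ Measurable fun g : orthogonalGroup (Fin n) ℝ => G (act g (baseFrame hk)) :=
  ((measurable_act_base hk).measurable_comp_iff_of_surjective (surjective_act_base hk)).symm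

lemma lintegral_fibre_fibre {φ : Stiefel n m → ℝ≥0∞} (hφ : Measurable φ)
    (g : orthogonalGroup (Fin (n - m)) ℝ) :
    ∫⁻ ω, φ (fibre (fibre v (act g (baseFrame (show k ≤ n - m by omega)))) ω)
      ∂stiefelMeasure (n - k) m =
    ∫⁻ ω, φ (comp (fibreFrame h v g) ω) ∂stiefelMeasure (n - k) m := by
  have e := map_fibre (m := m) _ _ (transpose_mul_fibreFrame h v g)
  have e1 := lintegral_map (μ := stiefelMeasure (n - k) m) hφ (measurable_comp_right
    (complFrame (fibre v (act g (baseFrame (show k ≤ n - m by omega))))))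
  have e2 := lintegral_map (μ := stiefelMeasure (n - k) m) hφ
    (measurable_comp_right (fibreFrame h v g))
  refine e1.symm.trans (Eq.trans ?_ e2)
  exact congrArg (fun μ => ∫⁻ w, φ w ∂μ) e

lemma measurable_lintegral_fibre (h : m + k ≤ n) (v : Stiefel n m) {φ : Stiefel n m → ℝ≥0∞} (hφ : Measurable φ) :
    Measurable fun θ : Stiefel (n - m) k =>
      ∫⁻ ω, φ (fibre (fibre v θ) ω) ∂stiefelMeasure (n - k) m := by
  rw [measurable_iff_act_base (show k ≤ n - m by omega)]
  simp_rw [lintegral_fibre_fibre h v hφ]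
  exact (hφ.comp (measurable_comp_fibreFrame h v)).lintegral_prod_right'

lemma lintegral_fibre_eq_fibreLaw {φ : Stiefel n m → ℝ≥0∞} (hφ : Measurable φ) :
    ∫⁻ θ, ∫⁻ ω, φ (fibre (fibre v θ) ω) ∂stiefelMeasure (n - k) m ∂stiefelMeasure (n - m) k =
      ∫⁻ w, φ w ∂fibreLaw h v := by
  have hk : k ≤ n - m := by omega
  conv_lhs => rw [stiefelMeasure.eq_def (n - m) k, dif_pos hk]
  rw [lintegral_map (measurable_lintegral_fibre h v hφ) (measurable_act_base hk),
    lintegral_fibreLaw h v hφ]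
  simp_rw [lintegral_fibre_fibre h v hφ]

end Law

/-! ### Integrability and the factorization -/

section Factorization

variable {n m k : ℕ}

lemma measurable_kernelDensity (v : Stiefel n m) : Measurable fun w : Stiefel n m =>
    ENNReal.ofReal (funkConstant n m k * sineKernel n m ((n : ℝ) - k - m) v w) :=
  ((measurable_sineKernel_right _ v).const_mul _).ennreal_ofReal

lemma isProbabilityMeasure_fibreLaw (h : m + k ≤ n) (hm : m ≤ n - k) (v : Stiefel n m) :
    IsProbabilityMeasure (fibreLaw h v) := by
  have := isProbabilityMeasure_stiefelMeasure hm
  exact Measure.isProbabilityMeasure_map (measurable_comp_fibreFrame h v).aemeasurable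

/-- The density has mass one in `w`, hence by symmetry also in `v`. Tonelli then gives the integral
over `v` the value `∫ φ`, which is finite. -/
lemma ae_lintegral_fibreLaw_lt_top (h : m + k ≤ n) (h₂ : 2 * m + k ≤ n) {φ : Stiefel n m → ℝ≥0∞}
    (hφ : Measurable φ) (hfin : ∫⁻ w, φ w ∂stiefelMeasure n m ≠ ∞) :
    ∀ᵐ v ∂stiefelMeasure n m, ∫⁻ w, φ w ∂fibreLaw h v < ∞ := by
  set D : Stiefel n m → Stiefel n m → ℝ≥0∞ := fun v w =>
    ENNReal.ofReal (funkConstant n m k * sineKernel n m ((n : ℝ) - k - m) v w) with hD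
  have hDm : ∀ v, Measurable (D v) := fun v => measurable_kernelDensity v
  have hDm₂ : Measurable fun x : Stiefel n m × Stiefel n m => D x.1 x.2 :=
    ((measurable_sineKernel ((n : ℝ) - k - m)).const_mul (funkConstant n m k)).ennreal_ofReal
  have hlaw : ∀ v, ∫⁻ w, φ w ∂fibreLaw h v = ∫⁻ w, D v w * φ w ∂stiefelMeasure n m := fun v => by
    rw [fibreLaw_eq h v h₂, lintegral_withDensity_eq_lintegral_mul _ (hDm v) hφ]
    rfl
  have hone : ∀ w, ∫⁻ v, D v w ∂stiefelMeasure n m = 1 := fun w => by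
    have := isProbabilityMeasure_fibreLaw h (by omega) w
    have e : fibreLaw h w Set.univ = 1 := measure_univ
    rw [fibreLaw_eq h w h₂, withDensity_apply _ MeasurableSet.univ, Measure.restrict_univ] at e
    refine Eq.trans (lintegral_congr fun v => ?_) e
    rw [hD]
    simp only [sineKernel_comm _ v w]
  have hmeas : Measurable fun x : Stiefel n m × Stiefel n m => D x.1 x.2 * φ x.2 :=
    hDm₂.mul (hφ.comp measurable_snd)
  simp_rw [hlaw]
  refine ae_lt_top (hmeas.lintegral_prod_right') ?_
  have hswap := lintegral_lintegral_swap (μ := stiefelMeasure n m) (ν := stiefelMeasure n m)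
    (f := fun v w => D v w * φ w) hmeas.aemeasurable
  have hDm' : ∀ w, Measurable fun v => D v w := fun w => by
    have h1 : Measurable fun v : Stiefel n m => (v, w) := measurable_prodMk_right
    have h2 := hDm₂.comp h1
    exact h2
  rw [hswap]
  simp_rw [lintegral_mul_const _ (hDm' _), hone, one_mul]
  exact hfin

variable {𝕜 : Type*} [RCLike 𝕜]

lemma integral_fibre_fibre (h : m + k ≤ n) (v : Stiefel n m) (f : Stiefel n m → 𝕜)
    (g : orthogonalGroup (Fin (n - m)) ℝ) :
    funk n m k f (fibre v (act g (baseFrame (show k ≤ n - m by omega)))) =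
      ∫ ω, f (comp (fibreFrame h v g) ω) ∂stiefelMeasure (n - k) m :=
  integral_fibre f _ _ (transpose_mul_fibreFrame h v g)

lemma stronglyMeasurable_funk_fibre (h : m + k ≤ n) (v : Stiefel n m) {f : Stiefel n m → 𝕜}
    (hf : StronglyMeasurable f) :
    StronglyMeasurable fun θ : Stiefel (n - m) k => funk n m k f (fibre v θ) := by
  refine Measurable.stronglyMeasurable ?_
  rw [measurable_iff_act_base (show k ≤ n - m by omega)]
  simp_rw [integral_fibre_fibre h v f]
  exact (hf.comp_measurable
    (measurable_comp_fibreFrame h v)).integral_prod_right'.measurable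

/-- By Fubini the iterated integral is the integral of `f` against `fibreLaw`, whose density is
known. -/
lemma dualFunk_funk_eq (h : m + k ≤ n) (h₂ : 2 * m + k ≤ n) (v : Stiefel n m)
    {f : Stiefel n m → 𝕜} (hf : StronglyMeasurable f) (hint : Integrable f (fibreLaw h v)) :
    dualFunk n m k (funk n m k f) v =
      funkConstant n m k • sineTransform n m ((n : ℝ) - k - m) f v := by
  have hk : k ≤ n - m := by omega
  have hsm := stronglyMeasurable_funk_fibre h v hf
  have hcomp := measurable_comp_fibreFrame h v
  have e1 : dualFunk n m k (funk n m k f) v = ∫ g, ∫ ω, f (comp (fibreFrame h v g) ω)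
      ∂stiefelMeasure (n - k) m ∂haarO (n - m) := by
    rw [dualFunk, stiefelMeasure.eq_def (n - m) k, dif_pos hk,
      integral_map (measurable_act_base hk).aemeasurable hsm.aestronglyMeasurable]
    simp_rw [integral_fibre_fibre h v f]
  have hint2 : Integrable (fun x : orthogonalGroup (Fin (n - m)) ℝ × Stiefel (n - k) m =>
      f (comp (fibreFrame h v x.1) x.2)) ((haarO (n - m)).prod (stiefelMeasure (n - k) m)) :=
    (integrable_map_measure hf.aestronglyMeasurable hcomp.aemeasurable).mp hint
  have e2 : ∫ w, f w ∂fibreLaw h v = ∫ g, ∫ ω, f (comp (fibreFrame h v g) ω)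
      ∂stiefelMeasure (n - k) m ∂haarO (n - m) := by
    rw [fibreLaw, integral_map hcomp.aemeasurable hf.aestronglyMeasurable]
    exact integral_prod _ hint2
  rw [e1, ← e2, fibreLaw_eq h v h₂, integral_withDensity_eq_integral_toReal_smul
    (measurable_kernelDensity v) (ae_of_all _ fun _ => ENNReal.ofReal_lt_top), sineTransform,
    ← integral_smul]
  refine integral_congr_ae (ae_of_all _ fun w => ?_)
  simp only
  rw [ENNReal.toReal_ofReal (mul_nonneg (funkConstant_pos h₂).le (sineKernel_nonneg _ _ _)),
    mul_smul]

/-- A single fibre may be a null set, so almost-everywhere statements do not restrict to every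
fibre. They do restrict to almost every fibre, since the law over all fibres is absolutely
continuous. -/
lemma ae_fibre_of_ae (h : m + k ≤ n) (h₂ : 2 * m + k ≤ n) (v : Stiefel n m)
    {p : Stiefel n m → Prop} (hp : ∀ᵐ w ∂stiefelMeasure n m, p w) :
    ∀ᵐ θ ∂stiefelMeasure (n - m) k, ∀ᵐ ω ∂stiefelMeasure (n - k) m, p (fibre (fibre v θ) ω) := by
  have hp' : ∀ᵐ w ∂fibreLaw h v, p w := by
    rw [fibreLaw_eq h v h₂]
    exact (withDensity_absolutelyContinuous _ _).ae_le hp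
  obtain ⟨N, hN, hNm, hN0⟩ := exists_measurable_superset_of_null (ae_iff.mp hp')
  have hφ : Measurable (N.indicator (1 : Stiefel n m → ℝ≥0∞)) := measurable_one.indicator hNm
  have e := lintegral_fibre_eq_fibreLaw h v hφ
  rw [lintegral_indicator_one hNm, hN0,
    lintegral_eq_zero_iff (measurable_lintegral_fibre h v hφ)] at e
  filter_upwards [e] with θ hθ
  have hfm : Measurable (fibre (fibre v θ) : Stiefel (n - k) m → Stiefel n m) :=
    measurable_comp_right _
  have hθ' := (lintegral_eq_zero_iff (hφ.comp hfm)).mp hθ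
  filter_upwards [hθ'] with ω hω
  by_contra hc
  have hmem : fibre (fibre v θ) ω ∈ N := hN hc
  simp [hmem] at hω

lemma integrable_smul_of_fibreLaw (h : m + k ≤ n) (h₂ : 2 * m + k ≤ n) (v : Stiefel n m)
    {f : Stiefel n m → 𝕜} (hint : Integrable f (fibreLaw h v)) :
    Integrable (fun w => sineKernel n m ((n : ℝ) - k - m) v w • f w) (stiefelMeasure n m) := by
  rw [fibreLaw_eq h v h₂, integrable_withDensity_iff_integrable_smul'
    (measurable_kernelDensity v) (ae_of_all _ fun _ => ENNReal.ofReal_lt_top)] at hint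
  have hC := funkConstant_pos h₂
  refine (hint.smul (funkConstant n m k)⁻¹).congr (ae_of_all _ fun w => ?_)
  simp only [Pi.smul_apply]
  rw [ENNReal.toReal_ofReal (mul_nonneg hC.le (sineKernel_nonneg _ _ _)), smul_smul,
    inv_mul_cancel_left₀ hC.ne']

end Factorization

/-! ### The theorem for integrable functions -/

theorem dualFunk_funk_eq_sineTransform {𝕜 : Type*} [RCLike 𝕜] (n m k : ℕ)
    (hmkn : 2 * m + k ≤ n) (f : Stiefel n m → 𝕜)
    (hf : Integrable f (stiefelMeasure n m)) :
    ∀ᵐ v ∂(stiefelMeasure n m),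
      (∀ᵐ θ ∂(stiefelMeasure (n - m) k),
        Integrable (fun ω => f (fibre (fibre v θ) ω))
          (stiefelMeasure (n - k) m)) ∧
      Integrable (fun θ => funk n m k f (fibre v θ))
        (stiefelMeasure (n - m) k) ∧
      Integrable (fun w => sineKernel n m ((n : ℝ) - k - m) v w • f w)
        (stiefelMeasure n m) ∧
      dualFunk n m k (funk n m k f) v =
        (siegelGamma m (((n : ℝ) - m) / 2) *
            siegelGamma m (((n : ℝ) - k) / 2) /
          (siegelGamma m ((n : ℝ) / 2) *
            siegelGamma m (((n : ℝ) - k - m) / 2))) •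
          sineTransform n m ((n : ℝ) - k - m) f v := by
  have h : m + k ≤ n := by omega
  -- An everywhere measurable representative makes the fibre integrals measurable in `u`; the
  -- conclusions return to `f` through `hae`, `hfunk` and `hff₀`.
  obtain ⟨f₀, hf₀, hff₀⟩ := hf.1
  have hf₀e : Measurable fun w => ‖f₀ w‖ₑ := hf₀.enorm
  have hfin : ∫⁻ w, ‖f₀ w‖ₑ ∂stiefelMeasure n m ≠ ⊤ := (hf.congr hff₀).2.ne
  filter_upwards [ae_lintegral_fibreLaw_lt_top h hmkn hf₀e hfin] with v hv
  have hint : Integrable f₀ (fibreLaw h v) := ⟨hf₀.aestronglyMeasurable, hv⟩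
  have hae := ae_fibre_of_ae h hmkn v hff₀
  have hfunk : (fun θ : Stiefel (n - m) k => funk n m k f₀ (fibre v θ))
      =ᵐ[stiefelMeasure (n - m) k] fun θ => funk n m k f (fibre v θ) := by
    filter_upwards [hae] with θ hθ
    exact (integral_congr_ae hθ).symm
  have hT := lintegral_fibre_eq_fibreLaw h v hf₀e
  refine ⟨?_, ?_, ?_, ?_⟩
  · have hlt := ae_lt_top (measurable_lintegral_fibre h v hf₀e) (by rw [hT]; exact hv.ne)
    filter_upwards [hae, hlt] with θ hθ hθ'
    have hfm : Measurable (fibre (fibre v θ) : Stiefel (n - k) m → Stiefel n m) :=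
      measurable_comp_right _
    have hi : Integrable (fun ω => f₀ (fibre (fibre v θ) ω)) (stiefelMeasure (n - k) m) :=
      ⟨(hf₀.comp_measurable hfm).aestronglyMeasurable, hθ'⟩
    refine hi.congr ?_
    filter_upwards [hθ] with ω hω using hω.symm
  · refine Integrable.congr ⟨(stronglyMeasurable_funk_fibre h v hf₀).aestronglyMeasurable, ?_⟩ hfunk
    refine lt_of_le_of_lt (lintegral_mono fun θ => ?_) (hT.trans_lt hv)
    exact enorm_integral_le_lintegral_enorm _
  · refine (integrable_smul_of_fibreLaw h hmkn v hint).congr ?_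
    filter_upwards [hff₀] with w hw
    rw [hw]
  · have e1 : dualFunk n m k (funk n m k f) v = dualFunk n m k (funk n m k f₀) v :=
      (integral_congr_ae hfunk).symm
    have e2 : sineTransform n m ((n : ℝ) - k - m) f v =
        sineTransform n m ((n : ℝ) - k - m) f₀ v := by
      refine integral_congr_ae ?_
      filter_upwards [hff₀] with w hw
      rw [hw]
    rw [e1, e2]
    exact dualFunk_funk_eq h hmkn v hf₀ hint

end FunkStiefel

end

theorem mainTheorem10 {𝕜 : Type*} [RCLike 𝕜] (n m k : ℕ) (hm : 1 ≤ m) (hk : 1 ≤ k)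
    (hmkn : 2 * m + k ≤ n) (f : FunkStiefel.Stiefel n m → 𝕜)
    (hf : Integrable f (FunkStiefel.stiefelMeasure n m)) :
    ∀ᵐ v ∂(FunkStiefel.stiefelMeasure n m),
      (∀ᵐ θ ∂(FunkStiefel.stiefelMeasure (n - m) k),
        Integrable (fun ω => f (FunkStiefel.fibre (FunkStiefel.fibre v θ) ω))
          (FunkStiefel.stiefelMeasure (n - k) m)) ∧
      Integrable (fun θ => FunkStiefel.funk n m k f (FunkStiefel.fibre v θ))
        (FunkStiefel.stiefelMeasure (n - m) k) ∧
      Integrable (fun w => FunkStiefel.sineKernel n m ((n : ℝ) - k - m) v w • f w)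
        (FunkStiefel.stiefelMeasure n m) ∧
      FunkStiefel.dualFunk n m k (FunkStiefel.funk n m k f) v =
        (FunkStiefel.siegelGamma m (((n : ℝ) - m) / 2) *
            FunkStiefel.siegelGamma m (((n : ℝ) - k) / 2) /
          (FunkStiefel.siegelGamma m ((n : ℝ) / 2) *
            FunkStiefel.siegelGamma m (((n : ℝ) - k - m) / 2))) •
          FunkStiefel.sineTransform n m ((n : ℝ) - k - m) f v := by
  exact FunkStiefel.dualFunk_funk_eq_sineTransform n m k hmkn f hf
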